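/- Let $n\ge 0$, $r\ge 3$ and $1\le t<2^r-r-1$ be integers, and let $[n]=\{1,\dots,n\}$. Sets $F_1,\dots,F_r\subseteq[n]$ agree on a coordinate $x\in[n]$ if $x$ belongs to all of them or to none of them. A family $\mathcal F\subseteq 2^{[n]}$ is $r$-wise $t$-agreeing if any $r$ (not necessarily distinct) sets from $\mathcal F$ agree on at least $t$ coordinates, and it is non-trivial if $\bigcap_{F\in\mathcal F}F=\emptyset$ and $\bigcup_{F\in\mathcal F}F=[n]$ (for $\mathcal F=\emptyset$ the intersection is $[n]$ and the union is $\emptyset$). Theorem. If $\mathcal F\subseteq 2^{[n]}$ is non-trivial and $r$-wise $t$-agreeing and $|\mathcal F|=(r+t+1)\,2^{n-r-t}$, then there are a set $A\subseteq[n]$ with $|A|=r+t$ and a subset $R\subseteq A$ such that $$\mathcal F=\{F'\,\Delta\,R : F'\subseteq[n],\ |F'\cap A|\le 1\},$$ where $\Delta$ denotes symmetric difference. Conversely, for every $(r+t)$-element set $A\subseteq[n]$ and every $R\subseteq A$ the family on the right is non-trivial, $r$-wise $t$-agreeing, and has exactly $(r+t+1)\,2^{n-r-t}$ members. -/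

import Mathlib

/-- The set of coordinates `x ∈ [n]` on which the sets `G 0, …, G (r-1)` agree:
`x` lies in all of them or in none of them. -/
def agreementSet {n r : ℕ} (G : Fin r → Finset (Fin n)) : Finset (Fin n) :=
  Finset.univ.filter fun x => (∀ i, x ∈ G i) ∨ (∀ i, x ∉ G i)

/-- `F` is `r`-wise `t`-agreeing: any `r` (not necessarily distinct) members of `F` agree on
at least `t` coordinates. -/
def IsAgreeing {n : ℕ} (r t : ℕ) (F : Finset (Finset (Fin n))) : Prop :=
  ∀ G : Fin r → Finset (Fin n), (∀ i, G i ∈ F) → t ≤ (agreementSet G).card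

/-- `F` is non-trivial: the intersection of its members is empty and their union is `[n]`. -/
def IsNontrivial {n : ℕ} (F : Finset (Finset (Fin n))) : Prop :=
  F.inf id = ∅ ∧ F.sup id = Finset.univ

/-- The family `{F' ∆ R : F' ⊆ [n], |F' ∩ A| ≤ 1}`. -/
def flippedFamily {n : ℕ} (A R : Finset (Fin n)) : Finset (Finset (Fin n)) :=
  (Finset.univ.filter fun F' : Finset (Fin n) => (F' ∩ A).card ≤ 1).image
    fun F' => symmDiff F' R

/-!
Write `s = r + t`. In a non-trivial family, any coordinate on which `k` members agree is separated
from them by a further member, so `r`-wise `t`-agreement forces `k`-wise `(s - k)`-agreement for all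
`k ≤ r` (`isAgreeing_of_le`). These conditions, unlike non-triviality, survive the compressions
that delete an element or replace an element by a larger one where possible. In a down-set they
bound the unions of `k` members. So the inequality `|F| ≤ (s + 1) 2 ^ (n - s)` has to be proved for
shifted down-sets only (`card_le_of_isAgreeing`). For the case of equality the compressions are
undone one at a time: if a compression of `F` is an extremal family, then in every pair of sets
exchanged by the compression of which exactly one lies in `F` the choice must be the same one, since
otherwise three members agree on fewer than `s - 3` coordinates
(`exists_eq_flippedFamily_of_downCompress`, `exists_eq_flippedFamily_of_shiftCompress`).

For a shifted down-set `F` on `[a, a + N)` with `{a} ∈ F` in which any `r` members miss `t` points,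
the bound on the density is proved by induction on `N` (`shiftedBound`), splitting `F` according to
its least elements. If `r` members of `F` miss `t` points, then `r` members not containing `a` miss
`t - 1` points of the remaining ground set, but `r` members containing `a` miss `t + r - 1` of them,
since all but one of these can trade `a` for a new element (`IsShifted.unionBounded_upper`).
Without the condition `{a} ∈ F` the bound becomes `2 ^ (-t)`, attained by the sets avoiding `t`
points (`ShiftedBound.dens_le_of_le`).

* If `{a, a + t} ∉ F`, the members containing `a` avoid the next `t` elements. Their number and the
  inductive bound for the members without `a` add up to exactly the claim, and this is where
  equality can occur (`ShiftedBound.sparse`).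
* If `{a, a + t} ∈ F`, then `r - 1` members miss `t + 2` points
  (`IsShifted.unionBounded_of_pair`). Removing the `t` least elements one by one bounds the density
  by a sum of inductive bounds, and strict inequality follows (`dens_le_of_pair`,
  `ShiftedBound.dense_of_four_le`, `ShiftedBound.dense_of_three`). For this one also needs bounds
  slightly outside the admissible range of `t`, which come from the linear recursion
  `z (t + 1) ≤ (z t + z (t + r)) / 2` (`dens_le_mul_pow`).
* The estimate just described fails for `r = t = 3`. There the sets avoiding the three least
  elements could have density almost `1 / 2`, and those with exactly one of these elements almost
  `7 / 64`. Both cannot happen at once. Let `C` be the family of those members that contain `a + 2`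
  but not `a` and `a + 1`, with `a + 2` removed. Either `C` misses an arithmetic progression of
  difference `4`, and then it is sparse (`dens_le_pow_of_progression_notMem`); or it contains a
  cover of the ground set by few blocks, none of which covers the ground set together with two of
  the sets avoiding the three least elements, and then an Efron–Stein inequality keeps the density
  of the latter away from `1 / 2` (`dens_lt_of_blocks`, `ShiftedBound.dense_of_three_three`).
-/

namespace Agreeing

open Finset

/-! ### Shifted down-sets and unions of their members -/

/-- `F` is a down-set of subsets of the interval `[a, a + N)` that is stable under replacing an
element of a member by a larger one. -/
structure IsShifted (a N : ℕ) (F : Finset (Finset ℕ)) : Prop where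
  sub : ∀ A ∈ F, A ⊆ Ico a (a + N)
  down : ∀ A ∈ F, ∀ B, B ⊆ A → B ∈ F
  shift : ∀ A ∈ F, ∀ x ∈ A, ∀ y, x < y → y < a + N → insert y (A.erase x) ∈ F

/-- `UnionOf F k U` says that `U` is the union of `k` (not necessarily distinct) members of `F`. -/
def UnionOf (F : Finset (Finset ℕ)) : ℕ → Finset ℕ → Prop
  | 0, U => U = ∅
  | k + 1, U => ∃ A ∈ F, ∃ U', UnionOf F k U' ∧ U = A ∪ U'

/-- Any `k` members of `F` have a union missing at least `t` out of `N` points. -/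
def UnionBounded (F : Finset (Finset ℕ)) (k N t : ℕ) : Prop :=
  ∀ U, UnionOf F k U → U.card + t ≤ N

/-- The proportion of the subsets of an `N`-element set that belong to `F`. -/
def dens (F : Finset (Finset ℕ)) (N : ℕ) : ℚ := (F.card : ℚ) / 2 ^ N

lemma dens_mono {F G : Finset (Finset ℕ)} (h : F ⊆ G) (N : ℕ) : dens F N ≤ dens G N := by
  unfold dens
  have : (F.card : ℚ) ≤ G.card := by exact_mod_cast card_le_card h
  gcongr

lemma dens_split (F : Finset (Finset ℕ)) (a N : ℕ) :
    dens F (N + 1) =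
      (dens (F.nonMemberSubfamily a) N + dens (F.memberSubfamily a) N) / 2 := by
  have h := card_memberSubfamily_add_card_nonMemberSubfamily a F
  have h' : (F.card : ℚ) = (F.memberSubfamily a).card + (F.nonMemberSubfamily a).card := by
    exact_mod_cast h.symm
  unfold dens
  rw [h', pow_succ]
  field_simp
  ring

lemma IsShifted.lower {a N : ℕ} {F : Finset (Finset ℕ)} (h : IsShifted a (N + 1) F) :
    IsShifted (a + 1) N (F.nonMemberSubfamily a) where
  sub A hA x hx := by
    rw [mem_nonMemberSubfamily] at hA
    have := mem_Ico.1 (h.sub A hA.1 hx)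
    have hne : x ≠ a := fun e => hA.2 (e ▸ hx)
    exact mem_Ico.2 (by omega)
  down A hA B hB := by
    rw [mem_nonMemberSubfamily] at hA ⊢
    exact ⟨h.down A hA.1 B hB, fun hb => hA.2 (hB hb)⟩
  shift A hA x hx y hxy hy := by
    rw [mem_nonMemberSubfamily] at hA ⊢
    refine ⟨h.shift A hA.1 x hx y hxy (by omega), ?_⟩
    have := mem_Ico.1 (h.sub A hA.1 hx)
    simp only [mem_insert, mem_erase, not_or, not_and]
    exact ⟨by omega, fun _ => hA.2⟩

lemma IsShifted.upper {a N : ℕ} {F : Finset (Finset ℕ)} (h : IsShifted a (N + 1) F) :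
    IsShifted (a + 1) N (F.memberSubfamily a) where
  sub A hA x hx := by
    rw [mem_memberSubfamily] at hA
    have := mem_Ico.1 (h.sub _ hA.1 (mem_insert_of_mem hx))
    have hne : x ≠ a := fun e => hA.2 (e ▸ hx)
    exact mem_Ico.2 (by omega)
  down A hA B hB := by
    rw [mem_memberSubfamily] at hA ⊢
    exact ⟨h.down _ hA.1 _ (insert_subset_insert _ hB), fun hb => hA.2 (hB hb)⟩
  shift A hA x hx y hxy hy := by
    rw [mem_memberSubfamily] at hA ⊢
    have hax := mem_Ico.1 (h.sub _ hA.1 (mem_insert_of_mem hx))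
    have hne : x ≠ a := fun e => hA.2 (e ▸ hx)
    have := h.shift _ hA.1 x (mem_insert_of_mem hx) y hxy (by omega)
    rw [erase_insert_of_ne hne.symm, Finset.insert_comm] at this
    refine ⟨this, ?_⟩
    simp only [mem_insert, mem_erase, not_or, not_and]
    exact ⟨by omega, fun _ => hA.2⟩

/-- Lifting the least element `a` to `a + 1` embeds `{A : a ∈ A, a + 1 ∉ A}` into
`{A : a ∉ A, a + 1 ∈ A}`. -/
lemma IsShifted.upper_lower_subset_lower_upper {a N : ℕ} {F : Finset (Finset ℕ)}
    (h : IsShifted a N F) (hN : 2 ≤ N) :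
    (F.memberSubfamily a).nonMemberSubfamily (a + 1) ⊆
      (F.nonMemberSubfamily a).memberSubfamily (a + 1) := by
  intro A hA
  simp only [mem_memberSubfamily, mem_nonMemberSubfamily] at hA ⊢
  obtain ⟨⟨h1, h2⟩, h3⟩ := hA
  have := h.shift _ h1 a (mem_insert_self _ _) (a + 1) (by omega) (by omega)
  rw [erase_insert h2] at this
  exact ⟨⟨this, by simp [h2]⟩, h3⟩

lemma IsShifted.empty_mem {a N : ℕ} {F : Finset (Finset ℕ)} (h : IsShifted a N F)
    (hF : F.Nonempty) : ∅ ∈ F := by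
  obtain ⟨A, hA⟩ := hF
  exact h.down A hA _ (empty_subset _)

lemma IsShifted.subset_powerset {a N : ℕ} {F : Finset (Finset ℕ)} (h : IsShifted a N F) :
    F ⊆ (Ico a (a + N)).powerset := fun A hA => mem_powerset.2 (h.sub A hA)

lemma IsShifted.dens_le_one {a N : ℕ} {F : Finset (Finset ℕ)} (h : IsShifted a N F) :
    dens F N ≤ 1 := by
  have := card_le_card h.subset_powerset
  rw [card_powerset, Nat.card_Ico, Nat.add_sub_cancel_left] at this
  unfold dens
  rw [div_le_one (by positivity)]
  exact_mod_cast this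

lemma IsShifted.singleton_mem {a N : ℕ} {F : Finset (Finset ℕ)} (h : IsShifted a N F)
    {x y : ℕ} (hx : {x} ∈ F) (hxy : x ≤ y) (hy : y < a + N) : {y} ∈ F := by
  rcases hxy.eq_or_lt with rfl | hlt
  · exact hx
  · simpa using h.shift _ hx x (mem_singleton_self _) y hlt hy

lemma IsShifted.pair_mem {a N : ℕ} {F : Finset (Finset ℕ)} (h : IsShifted a N F)
    {x y x' y' : ℕ} (hx : {x, y} ∈ F) (hxx : x ≤ x') (hyy : y ≤ y') (hxy : x < y)
    (hxy' : x' < y') (hy : y' < a + N) : {x', y'} ∈ F := by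
  have h1 : {x, y'} ∈ F := by
    rcases hyy.eq_or_lt with rfl | hlt
    · exact hx
    · have := h.shift _ hx y (by simp) y' hlt hy
      refine h.down _ this _ ?_
      intro z hz
      simp only [mem_insert, mem_singleton, mem_erase] at hz ⊢
      omega
  rcases hxx.eq_or_lt with rfl | hlt
  · exact h1
  · have := h.shift _ h1 x (by simp) x' hlt (by omega)
    refine h.down _ this _ ?_
    intro z hz
    simp only [mem_insert, mem_singleton, mem_erase] at hz ⊢
    omega

lemma UnionOf.mono {F G : Finset (Finset ℕ)} (h : F ⊆ G) {k : ℕ} {U : Finset ℕ}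
    (hU : UnionOf F k U) : UnionOf G k U := by
  induction k generalizing U with
  | zero => exact hU
  | succ k ih =>
    obtain ⟨A, hA, U', hU', rfl⟩ := hU
    exact ⟨A, h hA, U', ih hU', rfl⟩

lemma UnionOf.subset {F : Finset (Finset ℕ)} {V : Finset ℕ} (h : ∀ A ∈ F, A ⊆ V) {k : ℕ}
    {U : Finset ℕ} (hU : UnionOf F k U) : U ⊆ V := by
  induction k generalizing U with
  | zero => rw [show U = ∅ from hU]; exact empty_subset _
  | succ k ih =>
    obtain ⟨A, hA, U', hU', rfl⟩ := hU
    exact union_subset (h A hA) (ih hU')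

lemma unionOf_empty {F : Finset (Finset ℕ)} (h : ∅ ∈ F) (k : ℕ) : UnionOf F k ∅ := by
  induction k with
  | zero => rfl
  | succ k ih => exact ⟨∅, h, ∅, ih, by simp⟩

lemma UnionBounded.eq_empty {a N k t : ℕ} {F : Finset (Finset ℕ)} (hF : UnionBounded F k N t)
    (h : IsShifted a N F) (ht : N < t) : F = ∅ := by
  by_contra hne
  have := hF ∅ (unionOf_empty (h.empty_mem (nonempty_iff_ne_empty.2 hne)) k)
  omega

lemma dens_empty (N : ℕ) : dens ∅ N = 0 := by simp [dens]

lemma nonMemberSubfamily_subset (a : ℕ) (F : Finset (Finset ℕ)) :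
    F.nonMemberSubfamily a ⊆ F := filter_subset _ _

lemma UnionBounded.lower {F : Finset (Finset ℕ)} {k N t a : ℕ}
    (h : UnionBounded F k (N + 1) (t + 1)) : UnionBounded (F.nonMemberSubfamily a) k N t := by
  intro U hU
  have := h U (hU.mono (nonMemberSubfamily_subset a F))
  omega

/-- In `k` members containing `a`, the element `a` can be exchanged for `k` elements
outside a given set. -/
lemma IsShifted.exists_unionOf {a N : ℕ} {F : Finset (Finset ℕ)} (h : IsShifted a (N + 1) F)
    {k : ℕ} {U : Finset ℕ} (hU : UnionOf (F.memberSubfamily a) k U) (B : Finset ℕ)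
    (hB : B ⊆ Ico (a + 1) (a + 1 + N)) :
    ∃ U', UnionOf F k U' ∧ U' ⊆ Ico (a + 1) (a + 1 + N) ∧
      min ((B ∪ U).card + k) N ≤ (B ∪ U').card := by
  induction k generalizing U B with
  | zero =>
    rw [show U = ∅ from hU]
    exact ⟨∅, rfl, empty_subset _, by simp⟩
  | succ k ih =>
    obtain ⟨A, hA, U₀, hU₀, rfl⟩ := hU
    have hAsub := h.upper.sub A hA
    rw [mem_memberSubfamily] at hA
    obtain ⟨U', hU', hsub, hcard⟩ := ih hU₀ (B ∪ A) (union_subset hB hAsub)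
    have hAF : A ∈ F := h.down _ hA.1 _ (subset_insert _ _)
    rw [union_assoc, union_assoc] at hcard
    by_cases hfull : Ico (a + 1) (a + 1 + N) ⊆ B ∪ (A ∪ U')
    · refine ⟨A ∪ U', ⟨A, hAF, U', hU', rfl⟩, union_subset hAsub hsub, ?_⟩
      have := card_le_card hfull
      rw [Nat.card_Ico] at this
      omega
    · obtain ⟨y, hy, hyn⟩ := not_subset.1 hfull
      have hyI := mem_Ico.1 hy
      have hyA : insert y A ∈ F := by
        have := h.shift _ hA.1 a (mem_insert_self _ _) y (by omega) (by omega)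
        rwa [erase_insert hA.2] at this
      refine ⟨insert y A ∪ U', ⟨_, hyA, U', hU', rfl⟩,
        union_subset (insert_subset hy hAsub) hsub, ?_⟩
      have e : B ∪ (insert y A ∪ U') = insert y (B ∪ (A ∪ U')) := by
        ext z; simp only [mem_union, mem_insert]; tauto
      rw [e, card_insert_of_notMem hyn]
      omega

/-- Among the members containing the least element `a`, all but one of `k` sets can give up `a`
for a new element; hence the missing part of the union grows by `k - 1`. -/
lemma IsShifted.unionBounded_upper {a N k t : ℕ} {F : Finset (Finset ℕ)}
    (h : IsShifted a (N + 1) F) (hF : UnionBounded F (k + 1) (N + 1) (t + 1)) :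
    UnionBounded (F.memberSubfamily a) (k + 1) N (t + 1 + k) := by
  rintro _ ⟨A, hA, U, hU, rfl⟩
  have hAsub := h.upper.sub A hA
  obtain ⟨U', hU', hsub, hcard⟩ := h.exists_unionOf hU A hAsub
  rw [mem_memberSubfamily] at hA
  have h1 := hF _ ⟨_, hA.1, U', hU', rfl⟩
  have ha : a ∉ A ∪ U' := by
    intro hm
    have := mem_Ico.1 (union_subset hAsub hsub hm)
    omega
  rw [insert_union, card_insert_of_notMem ha] at h1
  omega

/-- When all singletons belong to `F`, fewer sets miss correspondingly more points. -/
lemma UnionBounded.of_singletons {a N k j t : ℕ} {F : Finset (Finset ℕ)} (hN : 1 ≤ N)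
    (h : IsShifted a N F) (hs : ∀ x ∈ Ico a (a + N), {x} ∈ F)
    (hF : UnionBounded F (k + j) N (t + 1)) : UnionBounded F k N (t + 1 + j) := by
  induction j generalizing k with
  | zero => exact hF
  | succ j ih =>
    have hF' := ih (k := k + 1) (by rwa [show k + 1 + j = k + (j + 1) by omega])
    intro U hU
    by_cases hfull : Ico a (a + N) ⊆ U
    · have := hF' (∅ ∪ U) ⟨∅, h.empty_mem ⟨_, hs a (by simp; omega)⟩, U, hU, rfl⟩
      have hc := card_le_card hfull
      rw [Nat.card_Ico] at hc
      rw [empty_union] at this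
      omega
    · obtain ⟨y, hy, hyn⟩ := not_subset.1 hfull
      have := hF' ({y} ∪ U) ⟨_, hs y hy, U, hU, rfl⟩
      rw [← insert_eq, card_insert_of_notMem hyn] at this
      omega

/-! ### Density bounds for families without a singleton condition -/

lemma two_mul_card_le {V : Finset ℕ} {F : Finset (Finset ℕ)} (hV : F ⊆ V.powerset)
    (hF : ∀ A ∈ F, V \ A ∉ F) : 2 * F.card ≤ 2 ^ V.card := by
  have hsubV : ∀ A ∈ F, A ⊆ V := fun A hA => mem_powerset.1 (hV hA)
  have hinj : Set.InjOn (fun A => V \ A) (F : Set (Finset ℕ)) := by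
    intro A hA B hB hAB
    have : V \ (V \ A) = V \ (V \ B) := by simpa using congrArg (V \ ·) hAB
    rwa [Finset.sdiff_sdiff_eq_self (hsubV A hA),
      Finset.sdiff_sdiff_eq_self (hsubV B hB)] at this
  have hdisj : Disjoint F (F.image fun A => V \ A) := by
    rw [disjoint_left]
    intro A hA hA'
    obtain ⟨B, hB, rfl⟩ := mem_image.1 hA'
    exact hF B hB hA
  have hsub : F ∪ (F.image fun A => V \ A) ⊆ V.powerset := by
    refine union_subset hV fun A hA => ?_
    obtain ⟨B, hB, rfl⟩ := mem_image.1 hA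
    exact mem_powerset.2 sdiff_subset
  have hc := card_le_card hsub
  rw [card_union_of_disjoint hdisj, card_image_of_injOn hinj, card_powerset] at hc
  omega

/-- A family without a pair of members covering the ground set has density at most `1 / 2`. -/
lemma dens_le_half {a N : ℕ} {F : Finset (Finset ℕ)} (h : IsShifted a N F)
    (hF : UnionBounded F 2 N 1) : dens F N ≤ 1 / 2 := by
  have hVc : (Ico a (a + N)).card = N := by simp
  have hc := two_mul_card_le h.subset_powerset fun A hA hA' => by
    have := hF (Ico a (a + N) \ A ∪ (A ∪ ∅)) ⟨_, hA', _, ⟨A, hA, ∅, rfl, rfl⟩, rfl⟩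
    rw [union_empty, sdiff_union_of_subset (h.sub A hA), hVc] at this
    omega
  rw [hVc] at hc
  unfold dens
  rw [div_le_div_iff₀ (by positivity) (by norm_num)]
  have : ((2 * F.card : ℕ) : ℚ) ≤ (2 ^ N : ℕ) := by exact_mod_cast hc
  push_cast at this
  linarith

/-- The decay rate of the density in the number of missed points: if `2 β ≥ 1 + β ^ r`, each
further missed point costs a factor `β`, starting from any known bound `c` for `t₀` points. -/
lemma dens_le_mul_pow {r t₀ M : ℕ} {c β : ℚ} (hr : 1 ≤ r) (hc : 0 ≤ c) (hβ : 0 ≤ β)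
    (hβr : 1 + β ^ r ≤ 2 * β)
    (H : ∀ N ≤ M, ∀ a F, IsShifted a N F → UnionBounded F r N t₀ → dens F N ≤ c)
    {N : ℕ} (hN : N ≤ M) {d a : ℕ} {F : Finset (Finset ℕ)} (h : IsShifted a N F)
    (hF : UnionBounded F r N (t₀ + d)) : dens F N ≤ c * β ^ d := by
  obtain ⟨k, rfl⟩ : ∃ k, r = k + 1 := ⟨r - 1, by omega⟩
  induction N generalizing d a F with
  | zero =>
    rcases Nat.eq_zero_or_pos d with rfl | hd
    · simpa using H 0 hN a F h hF
    · rw [hF.eq_empty h (by omega), dens_empty]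
      positivity
  | succ N ih =>
    rcases d with _ | d
    · simpa using H _ hN a F h hF
    · have h0 := ih (by omega) h.lower (d := d) hF.lower
      have h1 := ih (by omega) h.upper (d := d + (k + 1))
        (by rw [show t₀ + (d + (k + 1)) = t₀ + d + 1 + k by omega]
            exact h.unionBounded_upper hF)
      rw [dens_split F a N]
      have : c * β ^ d * (1 + β ^ (k + 1)) ≤ c * β ^ d * (2 * β) := by gcongr
      calc _ ≤ (c * β ^ d + c * β ^ (d + (k + 1))) / 2 := by linarith
        _ = c * β ^ d * (1 + β ^ (k + 1)) / 2 := by ring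
        _ ≤ c * β ^ (d + 1) := by rw [pow_succ β d]; linarith

/-- The elements of `[a, a + N)` in the residue class of `a + p - 1` modulo `4`, from `a + p - 1`
on. -/
def progression (a N p : ℕ) : Finset ℕ :=
  (Ico a (a + N)).filter fun x => a + p ≤ x + 1 ∧ (x + 1 - (a + p)) % 4 = 0

lemma mem_progression {a N p x : ℕ} : x ∈ progression a N p ↔
    (a ≤ x ∧ x < a + N) ∧ a + p ≤ x + 1 ∧ (x + 1 - (a + p)) % 4 = 0 := by
  rw [progression, mem_filter, mem_Ico]

/-- A shifted family that misses a progression of difference `4` is sparse: each of its members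
must lag behind the progression somewhere. -/
lemma dens_le_pow_of_progression_notMem {β : ℚ} (hβ : 0 ≤ β) (hβ4 : 1 + β ^ 4 ≤ 2 * β)
    {N p a : ℕ} {F : Finset (Finset ℕ)} (h : IsShifted a N F)
    (hF : progression a N p ∉ F) : dens F N ≤ β ^ p := by
  have hempty : ∀ {a' N' p' : ℕ} {G : Finset (Finset ℕ)}, IsShifted a' N' G → N' < p' →
      progression a' N' p' ∉ G → dens G N' ≤ β ^ p' := by
    intro a' N' p' G hG hp hnot
    have he : progression a' N' p' = ∅ := by
      refine filter_eq_empty_iff.2 fun x hx hx' => ?_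
      have := mem_Ico.1 hx
      omega
    rw [he] at hnot
    have : G = ∅ := by
      by_contra hne
      exact hnot (hG.empty_mem (nonempty_iff_ne_empty.2 hne))
    rw [this, dens_empty]
    positivity
  induction N generalizing p a F with
  | zero =>
    rcases Nat.eq_zero_or_pos p with rfl | hp
    · simpa using h.dens_le_one
    · exact hempty h hp hF
  | succ N ih =>
    rcases Nat.lt_or_ge (N + 1) p with hp | hp
    · exact hempty h hp hF
    rcases p with _ | p
    · simpa using h.dens_le_one
    have h0 : dens (F.nonMemberSubfamily a) N ≤ β ^ p := by
      rcases Nat.eq_zero_or_pos p with rfl | hp0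
      · simpa using h.lower.dens_le_one
      · refine ih h.lower fun hm => hF ?_
        rw [mem_nonMemberSubfamily] at hm
        convert hm.1 using 1
        ext x
        simp only [mem_progression]
        omega
    have h1 : dens (F.memberSubfamily a) N ≤ β ^ (p + 4) := by
      refine ih h.upper fun hm => hF ?_
      rw [mem_memberSubfamily] at hm
      rcases Nat.eq_zero_or_pos p with rfl | hp0
      · refine h.down _ hm.1 _ fun x hx => ?_
        simp only [mem_progression, mem_insert] at hx ⊢
        omega
      · have := h.shift _ hm.1 a (mem_insert_self _ _) (a + p) (by omega) (by omega)
        rw [erase_insert hm.2] at this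
        refine h.down _ this _ fun x hx => ?_
        simp only [mem_progression, mem_insert] at hx ⊢
        omega
    rw [dens_split F a N]
    have : β ^ p * (1 + β ^ 4) ≤ β ^ p * (2 * β) := by gcongr
    calc _ ≤ (β ^ p + β ^ (p + 4)) / 2 := by linarith
      _ = β ^ p * (1 + β ^ 4) / 2 := by ring
      _ ≤ β ^ (p + 1) := by rw [pow_succ β p]; linarith

/-! ### A variance inequality -/

/-- The set that agrees with `y` on `U` and with `x` elsewhere. -/
def mix (U x y : Finset ℕ) : Finset ℕ := x \ U ∪ y ∩ U

lemma mem_mix {U x y : Finset ℕ} {z : ℕ} :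
    z ∈ mix U x y ↔ (z ∈ x ∧ z ∉ U) ∨ (z ∈ y ∧ z ∈ U) := by
  simp [mix]

/-- The sets outside the family `F` that enter it when the elements of `S` are deleted. -/
def boundary (V : Finset ℕ) (F : Finset (Finset ℕ)) (S : Finset ℕ) : Finset (Finset ℕ) :=
  V.powerset.filter fun z => z \ S ∈ F ∧ z ∉ F

/-- The pairs `(x, y)` for which `x` leaves the family `F` when its trace on `U` is replaced by
that of `y`. -/
def exits (V : Finset ℕ) (F : Finset (Finset ℕ)) (U : Finset ℕ) :
    Finset (Finset ℕ × Finset ℕ) :=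
  (V.powerset ×ˢ V.powerset).filter fun p => p.1 ∈ F ∧ mix U p.1 p.2 ∉ F

lemma mix_swap_injOn (W : Finset ℕ) :
    Function.Injective fun p : Finset ℕ × Finset ℕ => (mix W p.1 p.2, mix W p.2 p.1) := by
  rintro ⟨x, y⟩ ⟨x', y'⟩ h
  simp only [Prod.mk.injEq] at h ⊢
  obtain ⟨h1, h2⟩ := h
  constructor
  · ext z
    have e1 := Finset.ext_iff.1 h1 z
    have e2 := Finset.ext_iff.1 h2 z
    rw [mem_mix, mem_mix] at e1 e2
    tauto
  · ext z
    have e1 := Finset.ext_iff.1 h1 z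
    have e2 := Finset.ext_iff.1 h2 z
    rw [mem_mix, mem_mix] at e1 e2
    tauto

lemma mix_mem_powerset {V U x y : Finset ℕ} (hx : x ∈ V.powerset) (hy : y ∈ V.powerset) :
    mix U x y ∈ V.powerset := by
  rw [mem_powerset] at *
  intro z hz
  rcases mem_mix.1 hz with h | h
  · exact hx h.1
  · exact hy h.1

lemma card_exits_union_le (V : Finset ℕ) {F : Finset (Finset ℕ)}
    (hdown : ∀ A ∈ F, ∀ B, B ⊆ A → B ∈ F) (U S : Finset ℕ) :
    (exits V F (U ∪ S)).card ≤ (exits V F U).card + (boundary V F S).card * 2 ^ V.card := by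
  set T := (V.powerset ×ˢ V.powerset).filter fun p : Finset ℕ × Finset ℕ =>
    mix (U ∪ S) p.1 p.2 ∈ boundary V F S with hT
  have h1 : exits V F (U ∪ S) ⊆ exits V F U ∪ T := by
    intro p hp
    rw [exits, mem_filter] at hp
    obtain ⟨hpV, hp1, hp2⟩ := hp
    have hpV' := mem_product.1 hpV
    by_cases hm : mix U p.1 p.2 ∈ F
    · refine mem_union_right _ (mem_filter.2 ⟨hpV, mem_filter.2
        ⟨mix_mem_powerset hpV'.1 hpV'.2, hdown _ hm _ fun z hz => ?_, hp2⟩⟩)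
      rw [mem_sdiff, mem_mix] at hz
      rw [mem_mix]
      simp only [mem_union] at hz
      tauto
    · exact mem_union_left _ (mem_filter.2 ⟨hpV, hp1, hm⟩)
  have h2 : T.card ≤ (boundary V F S ×ˢ V.powerset).card := by
    refine card_le_card_of_injOn _ (fun p hp => ?_) (mix_swap_injOn (U ∪ S)).injOn
    obtain ⟨hpV, hp⟩ := mem_filter.1 hp
    have hpV' := mem_product.1 hpV
    exact mem_product.2 ⟨hp, mix_mem_powerset hpV'.2 hpV'.1⟩
  rw [card_product, card_powerset] at h2
  have := (card_le_card h1).trans (card_union_le _ _)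
  omega

/-- For a single element the coordinate discarded by `mix` must be `0`, which saves a factor `2`
over the bound for general blocks. -/
lemma two_mul_card_exits_insert_le (V : Finset ℕ) {F : Finset (Finset ℕ)}
    (hdown : ∀ A ∈ F, ∀ B, B ⊆ A → B ∈ F) (U : Finset ℕ) {v : ℕ} (hv : v ∈ V) :
    2 * (exits V F (U ∪ {v})).card ≤
      2 * (exits V F U).card + (boundary V F {v}).card * 2 ^ V.card := by
  by_cases hvU : v ∈ U
  · rw [union_eq_left.2 (singleton_subset_iff.2 hvU)]
    omega
  set T := (V.powerset ×ˢ V.powerset).filter fun p : Finset ℕ × Finset ℕ =>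
    mix (U ∪ {v}) p.1 p.2 ∈ boundary V F {v} ∧ v ∉ p.1 with hT
  have h1 : exits V F (U ∪ {v}) ⊆ exits V F U ∪ T := by
    intro p hp
    rw [exits, mem_filter] at hp
    obtain ⟨hpV, hp1, hp2⟩ := hp
    have hpV' := mem_product.1 hpV
    by_cases hm : mix U p.1 p.2 ∈ F
    · refine mem_union_right _ (mem_filter.2 ⟨hpV, mem_filter.2
        ⟨mix_mem_powerset hpV'.1 hpV'.2, hdown _ hm _ fun z hz => ?_, hp2⟩, fun hvp => ?_⟩)
      · rw [mem_sdiff, mem_mix] at hz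
        rw [mem_mix]
        simp only [mem_union] at hz
        tauto
      · refine hp2 (hdown _ hm _ fun z hz => ?_)
        rw [mem_mix] at hz ⊢
        simp only [mem_union, mem_singleton] at hz
        by_cases hzv : z = v
        · subst hzv; tauto
        · tauto
    · exact mem_union_left _ (mem_filter.2 ⟨hpV, hp1, hm⟩)
  have h2 : T.card ≤ (boundary V F {v} ×ˢ (V.erase v).powerset).card := by
    refine card_le_card_of_injOn _ (fun p hp => ?_) (mix_swap_injOn (U ∪ {v})).injOn
    obtain ⟨hpV, hp, hvp⟩ := mem_filter.1 hp
    have hpV' := mem_product.1 hpV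
    refine mem_product.2 ⟨hp, ?_⟩
    have := mem_powerset.1 (mix_mem_powerset (U := U ∪ {v}) hpV'.2 hpV'.1)
    refine mem_powerset.2 fun z hz => mem_erase.2 ⟨?_, this hz⟩
    rintro rfl
    rw [mem_mix] at hz
    simp at hz
    tauto
  rw [card_product, card_powerset, card_erase_of_mem hv] at h2
  have h3 := (card_le_card h1).trans (card_union_le _ _)
  have h4 : 2 ^ V.card = 2 * 2 ^ (V.card - 1) := by
    rw [← pow_succ', Nat.sub_add_cancel (card_pos.2 ⟨v, hv⟩)]
  rw [h4]
  nlinarith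

/-- If two members of `F` and the block `S` never cover the ground set, then the sets `z` with
`z \ S ∈ F` contain no complementary pair. -/
lemma card_boundary_le {V : Finset ℕ} {F : Finset (Finset ℕ)} (hV : F ⊆ V.powerset)
    (hdown : ∀ A ∈ F, ∀ B, B ⊆ A → B ∈ F) {S : Finset ℕ}
    (hS : ∀ A ∈ F, ∀ B ∈ F, ¬ V ⊆ A ∪ B ∪ S) :
    2 * ((boundary V F S).card + F.card) ≤ 2 ^ V.card := by
  have hdisj : Disjoint (boundary V F S) F := by
    rw [disjoint_left]
    intro A hA
    exact (mem_filter.1 hA).2.2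
  rw [← card_union_of_disjoint hdisj]
  have key : ∀ A ∈ boundary V F S ∪ F, A \ S ∈ F := by
    intro A hA
    rcases mem_union.1 hA with hA | hA
    · exact (mem_filter.1 hA).2.1
    · exact hdown _ hA _ sdiff_subset
  refine two_mul_card_le (union_subset (filter_subset _ _) hV) fun A hA hA' => ?_
  refine hS _ (key _ hA) _ (key _ hA') fun z hz => ?_
  simp only [mem_union, mem_sdiff]
  tauto

/-- The two-copy form of the variance of the indicator function of `F`. -/
lemma card_exits_of_subset {V : Finset ℕ} {F : Finset (Finset ℕ)} (hV : F ⊆ V.powerset)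
    {U : Finset ℕ} (hU : V ⊆ U) : (exits V F U).card + F.card * F.card = F.card * 2 ^ V.card := by
  have h1 : exits V F U = F ×ˢ (V.powerset \ F) := by
    ext ⟨x, y⟩
    simp only [exits, mem_filter, mem_product, mem_sdiff]
    constructor
    · rintro ⟨⟨hx, hy⟩, h1, h2⟩
      refine ⟨h1, hy, fun h => h2 ?_⟩
      convert h using 1
      ext z
      have := fun h : z ∈ x => mem_powerset.1 hx h
      have := fun h : z ∈ y => mem_powerset.1 hy h
      have := fun h : z ∈ V => hU h
      rw [mem_mix]; tauto
    · rintro ⟨h1, hy, h2⟩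
      refine ⟨⟨hV h1, hy⟩, h1, fun h => h2 ?_⟩
      convert h using 1
      ext z
      have := fun h : z ∈ x => mem_powerset.1 (hV h1) h
      have := fun h : z ∈ y => mem_powerset.1 hy h
      have := fun h : z ∈ V => hU h
      rw [mem_mix]; tauto
  have h2 := card_sdiff_add_card_eq_card hV
  rw [card_powerset] at h2
  rw [h1, card_product, ← mul_add, h2]

/-- An Efron–Stein estimate: a family of density `a` for which three singletons and four further
blocks cover the ground set, while no block covers it together with two members, satisfies
`a (1 - a) ≤ (4 + 3 / 2) (1 / 2 - a)`, since the variance is at most the sum of the influences of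
the blocks. Hence `a` stays away from `1 / 2`: the smaller root of the corresponding equation is
`≈ 0.4549`, and `57 / 125 = 0.456`. -/
lemma dens_lt_of_blocks {b N : ℕ} (hN : 3 ≤ N) {F : Finset (Finset ℕ)} (h : IsShifted b N F)
    {S : Finset (Finset ℕ)}
    (hS : ∀ B ∈ S, ∀ A ∈ F, ∀ A' ∈ F, ¬ Ico b (b + N) ⊆ A ∪ A' ∪ B)
    (h0 : {b} ∈ S) (h1 : {b + 1} ∈ S) (h2 : {b + 2} ∈ S)
    (hP : ∀ j < 4, progression b N (4 + j) ∈ S) : dens F N < 57 / 125 := by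
  set V := Ico b (b + N) with hV
  have hVc : V.card = N := by simp [hV]
  have hd := h.down
  have hsub := h.subset_powerset
  have e0 : (exits V F ∅).card = 0 := by
    rw [card_eq_zero, exits, filter_eq_empty_iff]
    rintro p - ⟨hp1, hp2⟩
    simp [mix, hp1] at hp2
  have e1 := two_mul_card_exits_insert_le V hd ∅ (v := b) (by simp [hV]; omega)
  have e2 := two_mul_card_exits_insert_le V hd (∅ ∪ {b}) (v := b + 1) (by simp [hV]; omega)
  have e3 := two_mul_card_exits_insert_le V hd (∅ ∪ {b} ∪ {b + 1}) (v := b + 2)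
    (by simp [hV]; omega)
  have e4 := card_exits_union_le V hd (∅ ∪ {b} ∪ {b + 1} ∪ {b + 2}) (progression b N (4 + 0))
  have e5 := card_exits_union_le V hd (∅ ∪ {b} ∪ {b + 1} ∪ {b + 2} ∪ progression b N (4 + 0))
    (progression b N (4 + 1))
  have e6 := card_exits_union_le V hd (∅ ∪ {b} ∪ {b + 1} ∪ {b + 2} ∪ progression b N (4 + 0) ∪
    progression b N (4 + 1)) (progression b N (4 + 2))
  have e7 := card_exits_union_le V hd (∅ ∪ {b} ∪ {b + 1} ∪ {b + 2} ∪ progression b N (4 + 0) ∪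
    progression b N (4 + 1) ∪ progression b N (4 + 2)) (progression b N (4 + 3))
  have e8 := card_exits_of_subset (V := V) hsub (U := ∅ ∪ {b} ∪ {b + 1} ∪ {b + 2} ∪
    progression b N (4 + 0) ∪ progression b N (4 + 1) ∪ progression b N (4 + 2) ∪
    progression b N (4 + 3)) (by
      intro z hz
      have := mem_Ico.1 hz
      simp only [mem_union, mem_singleton, mem_progression, notMem_empty, false_or]
      omega)
  have b0 := card_boundary_le (V := V) hsub hd (hS _ h0)
  have b1 := card_boundary_le (V := V) hsub hd (hS _ h1)
  have b2 := card_boundary_le (V := V) hsub hd (hS _ h2)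
  have b3 := card_boundary_le (V := V) hsub hd (hS _ (hP 0 (by norm_num)))
  have b4 := card_boundary_le (V := V) hsub hd (hS _ (hP 1 (by norm_num)))
  have b5 := card_boundary_le (V := V) hsub hd (hS _ (hP 2 (by norm_num)))
  have b6 := card_boundary_le (V := V) hsub hd (hS _ (hP 3 (by norm_num)))
  rw [hVc] at e1 e2 e3 e4 e5 e6 e7 e8 b0 b1 b2 b3 b4 b5 b6
  have hM : (0 : ℚ) < 2 ^ N := by positivity
  set M := 2 ^ N with hMdef
  have key : ∀ x : ℕ, 2 * (x + F.card) ≤ M → 2 * (x * M) ≤ (M - 2 * F.card) * M := by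
    intro x hx
    rw [← mul_assoc]
    exact Nat.mul_le_mul_right _ (by omega)
  have k0 := key _ b0
  have k1 := key _ b1
  have k2 := key _ b2
  have k3 := key _ b3
  have k4 := key _ b4
  have k5 := key _ b5
  have k6 := key _ b6
  have hle : 2 * F.card ≤ M := by omega
  have tot : 4 * (F.card * M) ≤ 4 * (F.card * F.card) + 11 * ((M - 2 * F.card) * M) := by omega
  have totq : 4 * ((F.card : ℚ) * M) ≤
      4 * (F.card * F.card) + 11 * (((M : ℚ) - 2 * F.card) * M) := by
    have := (Nat.cast_le (α := ℚ)).2 tot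
    push_cast [Nat.cast_sub hle] at this
    exact this
  have hMq : (M : ℚ) = 2 ^ N := by rw [hMdef]; push_cast; rfl
  have hleq : 2 * (F.card : ℚ) ≤ M := by exact_mod_cast hle
  have hM' : (0 : ℚ) < M := by rw [hMq]; exact hM
  unfold dens
  rw [← hMq, div_lt_div_iff₀ hM' (by norm_num)]
  by_contra hcon
  push Not at hcon
  nlinarith

/-! ### The sparse and the dense case -/

/-- The subsets of `V` that meet `A` in at most one element. -/
def atMostOne {α : Type*} [DecidableEq α] (V A : Finset α) : Finset (Finset α) :=
  V.powerset.filter fun B => (B ∩ A).card ≤ 1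

lemma card_atMostOne {α : Type*} [DecidableEq α] {V A : Finset α} (hA : A ⊆ V) :
    (atMostOne V A).card * 2 ^ A.card = (A.card + 1) * 2 ^ V.card := by
  have h1 : (atMostOne V A).card =
      ((A.powerset.filter fun B => B.card ≤ 1) ×ˢ (V \ A).powerset).card := by
    refine card_bij' (fun B _ => (B ∩ A, B \ A)) (fun p _ => p.1 ∪ p.2) ?_ ?_ ?_ ?_
    · intro B hB
      simp only [atMostOne, mem_filter, mem_powerset, mem_product] at hB ⊢
      exact ⟨⟨inter_subset_right, hB.2⟩, sdiff_subset_sdiff hB.1 subset_rfl⟩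
    · rintro ⟨B, C⟩ hp
      simp only [atMostOne, mem_filter, mem_powerset, mem_product] at hp ⊢
      obtain ⟨⟨hB, hBc⟩, hC⟩ := hp
      refine ⟨union_subset (hB.trans hA) (hC.trans sdiff_subset), ?_⟩
      have : (B ∪ C) ∩ A = B := by
        ext z
        have := @hB z
        have := @hC z
        simp only [mem_inter, mem_union, mem_sdiff] at *
        tauto
      rwa [this]
    · intro B hB
      ext z
      simp only [mem_union, mem_inter, mem_sdiff]
      tauto
    · rintro ⟨B, C⟩ hp
      simp only [mem_filter, mem_powerset, mem_product] at hp
      obtain ⟨⟨hB, hBc⟩, hC⟩ := hp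
      simp only [Prod.mk.injEq]
      constructor <;> ext z <;>
      · have := @hB z
        have := @hC z
        simp only [mem_inter, mem_union, mem_sdiff] at *
        tauto
  have h2 : (A.powerset.filter fun B => B.card ≤ 1).card = A.card + 1 := by
    have : (A.powerset.filter fun B => B.card ≤ 1) =
        A.powersetCard 0 ∪ A.powersetCard 1 := by
      ext B
      simp only [mem_filter, mem_powerset, mem_union, mem_powersetCard]
      constructor
      · rintro ⟨h, h'⟩
        have : B.card = 0 ∨ B.card = 1 := by omega
        tauto
      · rintro (⟨h, h'⟩ | ⟨h, h'⟩) <;> exact ⟨h, by omega⟩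
    rw [this, card_union_of_disjoint, card_powersetCard, card_powersetCard]
    · simp [add_comm]
    · rw [disjoint_left]
      intro B hB hB'
      rw [mem_powersetCard] at hB hB'
      omega
  rw [h1, card_product, h2, card_powerset, card_sdiff_of_subset hA, mul_assoc, ← pow_add,
    Nat.sub_add_cancel (card_le_card hA)]

lemma UnionBounded.of_le {F : Finset (Finset ℕ)} {k N t t' : ℕ} (h : UnionBounded F k N t)
    (ht : t' ≤ t) : UnionBounded F k N t' := fun U hU => by
  have := h U hU
  omega

lemma IsShifted.singletons {a N : ℕ} {F : Finset (Finset ℕ)} (h : IsShifted a N F)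
    (ha : {a} ∈ F) : ∀ x ∈ Ico a (a + N), {x} ∈ F := fun _ hx =>
  h.singleton_mem ha (mem_Ico.1 hx).1 (mem_Ico.1 hx).2

lemma IsShifted.pos {a b N : ℕ} {F : Finset (Finset ℕ)} (h : IsShifted a N F)
    (hb : {b} ∈ F) : a ≤ b ∧ b < a + N := mem_Ico.1 (h.sub _ hb (mem_singleton_self b))

lemma IsShifted.add_le {a N r t : ℕ} {F : Finset (Finset ℕ)} (h : IsShifted a N F)
    (ha : {a} ∈ F) (hF : UnionBounded F r N (t + 1)) : r + (t + 1) ≤ N := by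
  have hN := h.pos ha
  have := UnionBounded.of_singletons (k := 0) (j := r) (by omega) h (h.singletons ha)
    (by rwa [zero_add])
  have := this ∅ rfl
  rw [card_empty] at this
  omega

lemma IsShifted.shrink {a N m : ℕ} {F : Finset (Finset ℕ)} (h : IsShifted a N F) (hm : m ≤ N)
    (hF : ∀ A ∈ F, ∀ x ∈ A, a + m ≤ x) : IsShifted (a + m) (N - m) F where
  sub A hA x hx := by
    have := hF A hA x hx
    have := mem_Ico.1 (h.sub A hA hx)
    exact mem_Ico.2 (by omega)
  down := h.down
  shift A hA x hx y hxy hy := h.shift A hA x hx y hxy (by omega)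

lemma dens_shrink (F : Finset (Finset ℕ)) {m N : ℕ} (hm : m ≤ N) :
    dens F N = dens F (N - m) / 2 ^ m := by
  unfold dens
  rw [div_div, ← pow_add, Nat.sub_add_cancel hm]

/-- The bound of the theorem for shifted down-sets on `N` points that contain all singletons,
with the description of the families attaining it. -/
def ShiftedBound (N : ℕ) : Prop :=
  ∀ (r t a : ℕ) (F : Finset (Finset ℕ)), 3 ≤ r → 1 ≤ t → r + t + 2 ≤ 2 ^ r →
    IsShifted a N F → {a} ∈ F → UnionBounded F r N t →
    dens F N ≤ (r + t + 1) / 2 ^ (r + t) ∧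
    (dens F N = (r + t + 1) / 2 ^ (r + t) →
      F = atMostOne (Ico a (a + N)) (Ico a (a + (r + t))))

/-- Without any condition on singletons, the best families are those of all sets avoiding `t`
points: either the least element is in no member and can be dropped, or all singletons are
members. -/
lemma ShiftedBound.dens_le_of_le {M : ℕ} (H : ∀ N ≤ M, ShiftedBound N) {N r t a : ℕ}
    {F : Finset (Finset ℕ)} (hN : N ≤ M) (hr : 3 ≤ r) (hrt : r + t + 2 ≤ 2 ^ r)
    (h : IsShifted a N F) (hF : UnionBounded F r N t) :
    dens F N ≤ 1 / 2 ^ t ∧ (dens F N = 1 / 2 ^ t → F = (Ico (a + t) (a + N)).powerset) := by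
  induction t generalizing N a with
  | zero =>
    refine ⟨by simpa using h.dens_le_one, fun heq => ?_⟩
    refine eq_of_subset_of_card_le h.subset_powerset ?_
    rw [pow_zero, div_one, dens, div_eq_one_iff_eq (by positivity)] at heq
    rw [card_powerset, Nat.card_Ico, add_zero, Nat.add_sub_cancel_left]
    exact_mod_cast heq.ge
  | succ t ih =>
    by_cases ha : {a} ∈ F
    · obtain ⟨hle, -⟩ := H N hN r (t + 1) a F hr (by omega) hrt h ha hF
      have hlt : ((r : ℚ) + (t + 1 : ℕ) + 1) / 2 ^ (r + (t + 1)) < 1 / 2 ^ (t + 1) := by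
        rw [div_lt_div_iff₀ (by positivity) (by positivity), pow_add (2 : ℚ) r (t + 1), one_mul]
        have : ((r : ℚ) + (t + 1 : ℕ) + 1) < 2 ^ r := by
          have : r + (t + 1) + 1 < 2 ^ r := by omega
          exact_mod_cast this
        exact mul_lt_mul_of_pos_right this (by positivity : (0 : ℚ) < 2 ^ (t + 1))
      exact ⟨(hle.trans_lt hlt).le, fun heq => absurd heq (hle.trans_lt hlt).ne⟩
    · rcases Nat.eq_zero_or_pos N with rfl | hN0
      · rw [hF.eq_empty h (by omega), dens_empty]
        exact ⟨by positivity, fun h0 => absurd h0.symm (by positivity)⟩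
      have hs := h.shrink (m := 1) hN0 fun A hA x hx => by
        have := mem_Ico.1 (h.sub A hA hx)
        have : x ≠ a := by
          rintro rfl
          exact ha (h.down A hA _ (singleton_subset_iff.2 hx))
        omega
      obtain ⟨h1, h2⟩ := ih (N := N - 1) (a := a + 1) (by omega) (by omega) hs (fun U hU => by
        have := hF U hU
        omega)
      rw [dens_shrink F (show 1 ≤ N from hN0), pow_succ (2 : ℚ) t, ← div_div, pow_one]
      refine ⟨by gcongr, fun heq => ?_⟩
      rw [h2 (by linarith)]
      congr 2 <;> omega

lemma two_mul_add_one_le {r : ℕ} (hr : 3 ≤ r) : 2 * r + 1 ≤ 2 ^ r := by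
  induction r, hr using Nat.le_induction with
  | base => norm_num
  | succ r hr ih => rw [pow_succ]; omega

/-- The case in which `{a, a + t}` is not a member: the members containing `a` then avoid
`[a + 1, a + t]`, so their number is bounded by `ShiftedBound.dens_le_of_le`, while the members
not containing `a` satisfy the hypotheses for `t - 1`, or for `r - 1` if `t = 1`. -/
lemma ShiftedBound.sparse {N r t a : ℕ} {F : Finset (Finset ℕ)}
    (H : ∀ N' ≤ N, ShiftedBound N') (hr : 3 ≤ r) (ht : 1 ≤ t) (hrt : r + t + 2 ≤ 2 ^ r)
    (h : IsShifted a (N + 1) F) (ha : {a} ∈ F) (hF : UnionBounded F r (N + 1) t)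
    (hpair : {a, a + t} ∉ F) :
    dens F (N + 1) ≤ (r + t + 1) / 2 ^ (r + t) ∧
    (dens F (N + 1) = (r + t + 1) / 2 ^ (r + t) →
      F = atMostOne (Ico a (a + (N + 1))) (Ico a (a + (r + t)))) := by
  obtain ⟨k, rfl⟩ : ∃ k, r = k + 1 := ⟨r - 1, by omega⟩
  obtain ⟨u, rfl⟩ : ∃ u, t = u + 1 := ⟨t - 1, by omega⟩
  have hN := h.add_le ha hF
  have hsing := h.singletons ha
  have hpow : (2 : ℚ) ^ (k + 1 + (u + 1)) = 2 * 2 ^ (k + 1 + u) := by rw [← pow_succ']; rfl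
  have hpos : (0 : ℚ) < 2 ^ (k + 1 + u) := by positivity
  -- the members containing `a`
  have havoid : ∀ A ∈ F.memberSubfamily a, ∀ x ∈ A, a + 1 + (u + 1) ≤ x := by
    intro A hA x hx
    have hxI := mem_Ico.1 (h.upper.sub A hA hx)
    rw [mem_memberSubfamily] at hA
    by_contra hlt
    refine hpair (h.pair_mem (x := a) (y := x) (h.down _ hA.1 _ ?_) le_rfl (by omega) (by omega)
      (by omega) (by omega))
    rw [insert_subset_iff, singleton_subset_iff]
    exact ⟨mem_insert_self _ _, mem_insert_of_mem hx⟩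
  obtain ⟨hu1, hu2⟩ := ShiftedBound.dens_le_of_le H (N := N - (u + 1)) (r := k + 1) (t := k)
    (by omega) hr (by have := two_mul_add_one_le hr; omega)
    (h.upper.shrink (m := u + 1) (by omega) havoid) (fun U hU => by
      have := h.unionBounded_upper hF U hU
      omega)
  have hupper : dens (F.memberSubfamily a) N ≤ 1 / 2 ^ (k + 1 + u) := by
    rw [dens_shrink (N := N) (m := u + 1) _ (by omega)]
    calc _ ≤ (1 / 2 ^ k : ℚ) / 2 ^ (u + 1) := by gcongr
      _ = 1 / 2 ^ (k + 1 + u) := by rw [div_div, ← pow_add]; congr 2; ring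
  -- the members not containing `a`
  have ha1 : {a + 1} ∈ F.nonMemberSubfamily a := by
    rw [mem_nonMemberSubfamily]
    exact ⟨hsing _ (mem_Ico.2 (by omega)), by simp⟩
  have hlower : dens (F.nonMemberSubfamily a) N ≤ (k + u + 2) / 2 ^ (k + 1 + u) := by
    rcases Nat.eq_zero_or_pos u with rfl | hu
    · have hF' : UnionBounded (F.nonMemberSubfamily a) k N 1 :=
        (UnionBounded.of_singletons (k := k) (j := 1) (by omega) h hsing hF).lower
      rcases Nat.lt_or_ge k 3 with hk | hk
      · obtain rfl : k = 2 := by omega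
        have := dens_le_half h.lower hF'
        norm_num
        linarith
      · have := (H N le_rfl k 1 _ _ hk le_rfl (by have := two_mul_add_one_le hk; omega)
          h.lower ha1 hF').1
        push_cast at this
        convert this using 2
        ring
    · have := (H N le_rfl (k + 1) u _ _ hr hu (by omega) h.lower ha1 hF.lower).1
      push_cast at this
      convert this using 2
      ring
  have hsum : (((k + 1 : ℕ) : ℚ) + (u + 1 : ℕ) + 1) / 2 ^ (k + 1 + (u + 1)) =
      ((k + u + 2) / 2 ^ (k + 1 + u) + 1 / 2 ^ (k + 1 + u)) / 2 := by
    rw [hpow]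
    push_cast
    field_simp
    ring
  rw [hsum, dens_split F a N]
  refine ⟨by linarith, fun heq => ?_⟩
  have hup : dens (F.memberSubfamily a) N = 1 / 2 ^ (k + 1 + u) := by linarith
  have hF1 : F.memberSubfamily a = (Ico (a + (k + 1 + (u + 1))) (a + (N + 1))).powerset := by
    rw [hu2]
    · congr 2 <;> omega
    · rw [dens_shrink (N := N) (m := u + 1) _ (by omega), div_eq_iff (by positivity)] at hup
      rw [hup, show k + 1 + u = k + (u + 1) by ring, pow_add]
      field_simp
  have hT : insert a (Ico (a + (k + 1 + (u + 1))) (a + (N + 1))) ∈ F :=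
    (mem_memberSubfamily.1 (hF1 ▸ mem_powerset_self _)).1
  have hF2 := UnionBounded.of_singletons (k := 2) (j := k - 1) (by omega) h hsing
    (by rwa [show 2 + (k - 1) = k + 1 by omega])
  have hsub : F ⊆ atMostOne (Ico a (a + (N + 1))) (Ico a (a + (k + 1 + (u + 1)))) := by
    intro A hA
    refine mem_filter.2 ⟨mem_powerset.2 (h.sub A hA), ?_⟩
    by_cases haA : a ∈ A
    · have : A.erase a ∈ F.memberSubfamily a := by
        rw [mem_memberSubfamily, insert_erase haA]
        exact ⟨hA, notMem_erase _ _⟩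
      rw [hF1, mem_powerset] at this
      refine (card_le_card (t := {a}) fun z hz => ?_).trans (card_singleton a).le
      rw [mem_inter, mem_Ico] at hz
      by_contra hne
      have := mem_Ico.1 (this (mem_erase.2 ⟨fun e => hne (mem_singleton.2 e), hz.1⟩))
      omega
    · by_contra hcard
      push Not at hcard
      have h1 := hF2 _ ⟨A, hA, _, ⟨_, hT, ∅, rfl, rfl⟩, rfl⟩
      have h2 : ((A ∩ Ico a (a + (k + 1 + (u + 1)))) ∪
          insert a (Ico (a + (k + 1 + (u + 1))) (a + (N + 1)))).card ≤
          (A ∪ (insert a (Ico (a + (k + 1 + (u + 1))) (a + (N + 1))) ∪ ∅)).card := by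
        rw [union_empty]
        exact card_le_card (union_subset_union_left inter_subset_left)
      rw [card_union_of_disjoint, card_insert_of_notMem, Nat.card_Ico] at h2
      · omega
      · rw [mem_Ico]; omega
      · rw [disjoint_left]
        intro z hz hz'
        rw [mem_inter, mem_Ico] at hz
        rw [mem_insert, mem_Ico] at hz'
        rcases hz' with rfl | hz'
        · exact haA hz.1
        · omega
  refine eq_of_subset_of_card_le hsub ?_
  have hc := card_atMostOne (V := Ico a (a + (N + 1))) (A := Ico a (a + (k + 1 + (u + 1))))
    (Ico_subset_Ico le_rfl (by omega))
  rw [Nat.card_Ico, Nat.card_Ico, Nat.add_sub_cancel_left, Nat.add_sub_cancel_left] at hc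
  rw [← dens_split F a N, ← hsum, dens, div_eq_div_iff (by positivity) (by positivity)] at heq
  have heq' : F.card * 2 ^ (k + 1 + (u + 1)) = (k + 1 + (u + 1) + 1) * 2 ^ (N + 1) := by
    exact_mod_cast heq
  rw [← hc] at heq'
  exact (Nat.eq_of_mul_eq_mul_right (by positivity) heq').ge

/-- The members containing a fixed element in the dense case: `r + q` points are missed and
`{a + q}` is a member. The steps that drop a non-member cost nothing, and each of the `q` steps
that keep an element contributes at most `K`. -/
lemma dens_upper_le {r Q M : ℕ} {K : ℚ} (hr : 1 ≤ r)
    (hY : ∀ N ≤ M, ∀ a F, IsShifted a N F → {a} ∈ F → UnionBounded F r N r →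
      dens F N ≤ (2 * r + 1) / 2 ^ (2 * r))
    (hz : ∀ N ≤ M, ∀ τ < 2 * r + Q, 2 * r ≤ τ → ∀ a F, IsShifted a N F → UnionBounded F r N τ →
      dens F N ≤ K / 2 ^ τ)
    {N q a : ℕ} {F : Finset (Finset ℕ)} (hN : N ≤ M) (hq : q ≤ Q) (h : IsShifted a N F)
    (hF : UnionBounded F r N (r + q)) (ha : {a + q} ∈ F) :
    dens F N ≤ (2 * r + 1 + K * q) / 2 ^ (2 * r + q) := by
  induction q generalizing N a F with
  | zero => simpa using hY N hN a F h ha hF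
  | succ q ih =>
    obtain ⟨k, rfl⟩ : ∃ k, r = k + 1 := ⟨r - 1, by omega⟩
    have hpos := h.pos ha
    obtain ⟨N, rfl⟩ : ∃ n, N = n + 1 := ⟨N - 1, by omega⟩
    have h0 := ih (N := N) (a := a + 1) (by omega) (by omega) h.lower hF.lower (by
      rw [mem_nonMemberSubfamily, show a + 1 + q = a + (q + 1) by ring]
      exact ⟨ha, by simp⟩)
    have h1 := hz N (by omega) (2 * (k + 1) + q) (by omega) (by omega) _ _ h.upper
      ((h.unionBounded_upper (t := k + 1 + q) hF).of_le (by omega))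
    rw [dens_split F a N]
    calc _ ≤ ((2 * (k + 1 : ℕ) + 1 + K * q) / 2 ^ (2 * (k + 1) + q) +
          K / 2 ^ (2 * (k + 1) + q)) / 2 := by linarith
      _ = _ := by
        rw [← add_assoc (2 * (k + 1)) q 1, pow_succ]
        push_cast
        field_simp
        ring

/-- A density bound in the dense case `{a, a + q + 1} ∈ F`, obtained by removing the least
elements one by one. What is left in the end misses no point for `r` sets, but two points for `r'`
sets, and contributes `c`. -/
lemma dens_le_of_pair {r r' Q M : ℕ} {K c : ℚ} (hr : 1 ≤ r)
    (hY : ∀ N ≤ M, ∀ a F, IsShifted a N F → {a} ∈ F → UnionBounded F r N r →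
      dens F N ≤ (2 * r + 1) / 2 ^ (2 * r))
    (hz : ∀ N ≤ M, ∀ τ < 2 * r + Q, 2 * r ≤ τ → ∀ a F, IsShifted a N F → UnionBounded F r N τ →
      dens F N ≤ K / 2 ^ τ)
    (hc : ∀ N ≤ M, ∀ a F, IsShifted a N F → {a} ∈ F → UnionBounded F r' N 2 →
      dens F N ≤ c / 2 ^ (2 * r))
    {N q a : ℕ} {F : Finset (Finset ℕ)} (hN : N ≤ M) (hq : q ≤ Q) (h : IsShifted a (N + 1) F)
    (hF : UnionBounded F r (N + 1) (q + 1)) (hF' : UnionBounded F r' (N + 1) (q + 3))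
    (ha : {a, a + (q + 1)} ∈ F) :
    dens F (N + 1) ≤
      (c + (q + 1) * (2 * r + 1) + K * ((q + 1) * q / 2)) / 2 ^ (2 * r + (q + 1)) := by
  have hpos := h.pos (h.down _ ha {a + (q + 1)} (by simp))
  have hupper : ∀ {N q a : ℕ} {F : Finset (Finset ℕ)}, N ≤ M → q ≤ Q → IsShifted a (N + 1) F →
      UnionBounded F r (N + 1) (q + 1) → {a, a + (q + 1)} ∈ F →
      dens (F.memberSubfamily a) N ≤ (2 * r + 1 + K * q) / 2 ^ (2 * r + q) := by
    intro N q a F hN hq h hF ha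
    obtain ⟨k, rfl⟩ : ∃ k, r = k + 1 := ⟨r - 1, by omega⟩
    refine dens_upper_le hr hY hz hN hq h.upper
      ((h.unionBounded_upper (t := q) hF).of_le (by omega)) ?_
    rw [mem_memberSubfamily, show a + 1 + q = a + (q + 1) by ring]
    exact ⟨ha, by simp⟩
  induction q generalizing N a F with
  | zero =>
    have h1 := hupper hN hq h hF ha
    have h0 := hc N hN _ _ h.lower (by
      rw [mem_nonMemberSubfamily]
      exact ⟨h.down _ ha _ (by simp), by simp⟩) hF'.lower
    rw [dens_split F a N]
    calc _ ≤ (c / 2 ^ (2 * r) + (2 * r + 1 + K * (0 : ℕ)) / 2 ^ (2 * r + 0)) / 2 := by linarith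
      _ = _ := by
        rw [zero_add, add_zero, pow_succ]
        push_cast
        field_simp
        ring
  | succ q ih =>
    have h1 := hupper hN hq h hF ha
    obtain ⟨N, rfl⟩ : ∃ n, N = n + 1 := ⟨N - 1, by omega⟩
    have h0 := ih (N := N) (a := a + 1) (by omega) (by omega) h.lower hF.lower hF'.lower (by
      rw [mem_nonMemberSubfamily]
      refine ⟨h.pair_mem (x := a) (y := a + (q + 1 + 1)) ha (by omega) (by omega) (by omega)
        (by omega) (by omega), by simp; omega⟩) (by omega)
    rw [dens_split F a (N + 1)]
    calc _ ≤ ((c + (q + 1) * (2 * r + 1) + K * ((q + 1) * q / 2)) / 2 ^ (2 * r + (q + 1)) +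
          (2 * r + 1 + K * (q + 1 : ℕ)) / 2 ^ (2 * r + (q + 1))) / 2 := by linarith
      _ = _ := by
        rw [← add_assoc (2 * r) (q + 1) 1, pow_succ (2 : ℚ) (2 * r + (q + 1))]
        push_cast
        field_simp
        ring

/-- In the dense case almost all pairs are members, so `r - 1` sets miss two points more than
`r` sets do. -/
lemma IsShifted.unionBounded_of_pair {a N k t : ℕ} {F : Finset (Finset ℕ)}
    (h : IsShifted a N F) (ha : {a} ∈ F) (hF : UnionBounded F (k + 1) N (t + 1))
    (hpair : {a, a + (t + 1)} ∈ F) : UnionBounded F k N (t + 3) := by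
  have hpos := h.pos ha
  intro U hU
  have h1 := UnionBounded.of_singletons (k := k) (j := 1) (by omega) h (h.singletons ha) hF U hU
  by_contra hlt
  have hUsub := hU.subset h.sub
  have hW : (Ico a (a + N) \ U).card = t + 2 := by
    rw [card_sdiff_of_subset hUsub, Nat.card_Ico]
    omega
  obtain ⟨y, hy, hay⟩ : ∃ y ∈ Ico a (a + N) \ U, a + (t + 1) ≤ y := by
    by_contra hcon
    push Not at hcon
    have := card_le_card (s := Ico a (a + N) \ U) (t := Ico a (a + (t + 1))) fun z hz => by
      have := hcon z hz
      rw [mem_sdiff, mem_Ico] at hz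
      exact mem_Ico.2 (by omega)
    rw [Nat.card_Ico] at this
    omega
  obtain ⟨x, hx, hxy⟩ : ∃ x ∈ Ico a (a + N) \ U, x ≠ y :=
    exists_mem_ne (by omega) y
  rw [mem_sdiff, mem_Ico] at hx hy
  have hxyF : {x, y} ∈ F := by
    rcases Nat.lt_or_ge x y with hlt | hge
    · exact h.pair_mem hpair hx.1.1 hay (by omega) hlt hy.1.2
    · rw [pair_comm]
      exact h.pair_mem hpair hy.1.1 (by omega) (by omega) (by omega) hx.1.2
  have h2 := hF _ ⟨_, hxyF, U, hU, rfl⟩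
  rw [insert_union, card_insert_of_notMem, ← insert_eq, card_insert_of_notMem hy.2] at h2
  · omega
  · rw [← insert_eq, mem_insert, not_or]
    exact ⟨hxy, hx.2⟩

/-! ### The dense case for `r ≥ 4` and for `r = 3`, `t ≤ 2` -/

lemma one_add_pow_mul_le_one {x : ℚ} (hx : 0 ≤ x) (m : ℕ) : (1 + x) ^ m * (1 - m * x) ≤ 1 := by
  induction m with
  | zero => simp
  | succ m ih =>
    refine le_trans ?_ ih
    rw [pow_succ, mul_assoc]
    refine mul_le_mul_of_nonneg_left ?_ (by positivity)
    push_cast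
    nlinarith [mul_nonneg (Nat.cast_nonneg (α := ℚ) m) (mul_nonneg hx hx), mul_nonneg hx hx]

lemma nine_mul_le {r : ℕ} (hr : 5 ≤ r) : 9 * r ≤ 2 ^ r + 13 := by
  induction r, hr using Nat.le_induction with
  | base => norm_num
  | succ r hr ih => rw [pow_succ]; omega

/-- The first estimate says that `β = (1 + 3 / (2 * 2 ^ r)) / 2` satisfies `1 + β ^ r ≤ 2 β`, the
second one that `(2 β) ^ (2 * r - 2) ≤ 7 / 4`. -/
lemma growth_bounds {r : ℕ} (hr : 4 ≤ r) :
    (1 + 3 / (2 * 2 ^ r) : ℚ) ^ r ≤ 3 / 2 ∧ (1 + 3 / (2 * 2 ^ r) : ℚ) ^ (2 * r - 2) ≤ 7 / 4 := by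
  rcases hr.eq_or_lt with rfl | hr5
  · norm_num
  have h9 := nine_mul_le hr5
  have h9q : (9 : ℚ) * r ≤ 2 ^ r + 13 := by exact_mod_cast h9
  have h32 : (32 : ℚ) ≤ 2 ^ r := by
    have : 2 ^ 5 ≤ 2 ^ r := Nat.pow_le_pow_right (by norm_num) hr5
    exact_mod_cast this
  set x : ℚ := 3 / (2 * 2 ^ r) with hx
  have hx0 : 0 ≤ x := by positivity
  have hxQ : x * 2 ^ r = 3 / 2 := by rw [hx]; field_simp
  have b1 := one_add_pow_mul_le_one hx0 r
  have b2 := one_add_pow_mul_le_one hx0 (2 * r - 2)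
  rw [Nat.cast_sub (by omega)] at b2
  push_cast at b2
  have hr5q : (5 : ℚ) ≤ r := by exact_mod_cast hr5
  have hxle : x ≤ 3 / 64 := by nlinarith
  have c1 : (r : ℚ) * x ≤ 1 / 3 := by nlinarith
  have c2 : (2 * (r : ℚ) - 2) * x ≤ 3 / 7 := by nlinarith
  have p1 : 0 ≤ (1 + x) ^ r := by positivity
  have p2 : 0 ≤ (1 + x) ^ (2 * r - 2) := by positivity
  constructor
  · nlinarith
  · nlinarith

/-- Slightly beyond the range in which sets avoiding `t` points are optimal, the density is still
at most `7 / 4` times that of such a family. -/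
lemma ShiftedBound.dens_le_beyond {M r τ : ℕ} (H : ∀ N ≤ M, ShiftedBound N) (hr : 4 ≤ r)
    (hτ : τ + 4 ≤ 2 ^ r + r) {N a : ℕ} {F : Finset (Finset ℕ)} (hN : N ≤ M)
    (h : IsShifted a N F) (hF : UnionBounded F r N τ) : dens F N ≤ (7 / 4) / 2 ^ τ := by
  have h2r := two_mul_add_one_le (r := r) (by omega)
  by_cases hle : r + τ + 2 ≤ 2 ^ r
  · refine (ShiftedBound.dens_le_of_le H hN (by omega) hle h hF).1.trans ?_
    gcongr
    norm_num
  obtain ⟨t₀, ht₀⟩ : ∃ t₀, r + t₀ + 2 = 2 ^ r := ⟨2 ^ r - r - 2, by omega⟩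
  obtain ⟨d, rfl⟩ : ∃ d, τ = t₀ + d := ⟨τ - t₀, by omega⟩
  obtain ⟨g1, g2⟩ := growth_bounds hr
  set x : ℚ := 3 / (2 * 2 ^ r) with hx
  have hx0 : 0 ≤ x := by positivity
  have hxQ : x * 2 ^ r = 3 / 2 := by rw [hx]; field_simp
  have hB := dens_le_mul_pow (r := r) (t₀ := t₀) (M := M) (c := 1 / 2 ^ t₀) (β := (1 + x) / 2)
    (by omega) (by positivity) (by positivity) (by
      rw [div_pow]
      have : (1 + x) ^ r / 2 ^ r ≤ x := by
        rw [div_le_iff₀ (by positivity), hxQ]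
        exact g1
      linarith)
    (fun N hN a F h hF => (ShiftedBound.dens_le_of_le H hN (by omega) ht₀.le h hF).1)
    hN h hF
  refine hB.trans ?_
  have hd : (1 + x) ^ d ≤ 7 / 4 :=
    (pow_le_pow_right₀ (by linarith) (by omega)).trans g2
  calc _ = (1 + x) ^ d / 2 ^ (t₀ + d) := by rw [div_pow, pow_add]; field_simp
    _ ≤ _ := by gcongr

lemma ShiftedBound.dense_of_four_le {N r t a : ℕ} {F : Finset (Finset ℕ)}
    (H : ∀ N' ≤ N, ShiftedBound N') (hr : 4 ≤ r) (ht : 1 ≤ t) (hrt : r + t + 2 ≤ 2 ^ r)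
    (h : IsShifted a (N + 1) F) (ha : {a} ∈ F) (hF : UnionBounded F r (N + 1) t)
    (hpair : {a, a + t} ∈ F) : dens F (N + 1) < (r + t + 1) / 2 ^ (r + t) := by
  obtain ⟨q, rfl⟩ : ∃ q, t = q + 1 := ⟨t - 1, by omega⟩
  obtain ⟨k, rfl⟩ : ∃ k, r = k + 1 := ⟨r - 1, by omega⟩
  have h2r := two_mul_add_one_le (r := k + 1) (by omega)
  have h2k := two_mul_add_one_le (r := k) (by omega)
  have hrange : k + 1 + (k + 1) + 2 ≤ 2 ^ (k + 1) := by
    rw [pow_succ]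
    omega
  have hb := dens_le_of_pair (r := k + 1) (r' := k) (Q := q) (M := N) (K := 7 / 4)
    (c := 2 ^ (k + 1) * (k + 3) / 2) (by omega)
    (fun N' hN' a F h ha hF => by
      have := (H N' hN' (k + 1) (k + 1) a F (by omega) (by omega) hrange h ha hF).1
      rw [← two_mul, ← two_mul] at this
      exact this)
    (fun N' hN' τ hτ _ a F h hF => ShiftedBound.dens_le_beyond H hr (by omega) hN' h hF)
    (fun N' hN' a F h ha hF => by
      have := (H N' hN' k 2 a F (by omega) (by omega) (by omega) h ha hF).1
      refine this.trans_eq ?_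
      rw [show 2 * (k + 1) = k + 1 + (k + 1) by ring, pow_add (2 : ℚ) (k + 1) (k + 1)]
      push_cast
      rw [pow_succ (2 : ℚ) k, pow_add (2 : ℚ) k 2]
      field_simp
      ring)
    le_rfl le_rfl h hF (h.unionBounded_of_pair ha hF hpair) hpair
  refine hb.trans_lt ?_
  rw [show 2 * (k + 1) + (q + 1) = (k + 1) + (k + 1 + (q + 1)) by ring,
    pow_add (2 : ℚ) (k + 1) (k + 1 + (q + 1)), ← div_div]
  refine (div_lt_div_iff_of_pos_right (by positivity)).2 ?_
  rw [div_lt_iff₀ (by positivity)]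
  set Q : ℚ := 2 ^ (k + 1) with hQ
  have hrtq : ((k : ℚ) + 1) + (q + 1) + 2 ≤ Q := by rw [hQ]; exact_mod_cast hrt
  have hq0 : (0 : ℚ) ≤ q := Nat.cast_nonneg q
  have hk3 : (3 : ℚ) ≤ k := by
    have : 3 ≤ k := by omega
    exact_mod_cast this
  push_cast
  rcases hr.eq_or_lt with h4 | h5
  · obtain rfl : k = 3 := by omega
    have hQ16 : Q = 16 := by rw [hQ]; norm_num
    rw [hQ16] at hrtq ⊢
    push_cast at hrtq ⊢
    nlinarith
  · have h9 : (9 : ℚ) * (k + 1) ≤ Q + 13 := by rw [hQ]; exact_mod_cast nine_mul_le h5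
    nlinarith [mul_nonneg hq0 (sub_nonneg.2 hrtq), mul_nonneg hq0 (sub_nonneg.2 h9)]

lemma ShiftedBound.dense_of_three {N t a : ℕ} {F : Finset (Finset ℕ)}
    (H : ∀ N' ≤ N, ShiftedBound N') (ht : 1 ≤ t) (ht2 : t ≤ 2)
    (h : IsShifted a (N + 1) F) (ha : {a} ∈ F) (hF : UnionBounded F 3 (N + 1) t)
    (hpair : {a, a + t} ∈ F) : dens F (N + 1) < (3 + t + 1) / 2 ^ (3 + t) := by
  obtain ⟨q, rfl⟩ : ∃ q, t = q + 1 := ⟨t - 1, by omega⟩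
  -- `0.61804` is just above the root `≈ 0.618034` of `1 + β ^ 3 = 2 β`, and `8 β ^ 3 ≤ 19 / 10`;
  -- `c = 32` stands for the density `1 / 2 = 32 / 2 ^ 6` of a family without complementary pairs
  have hb := dens_le_of_pair (r := 3) (r' := 2) (Q := q) (M := N) (K := 19 / 10)
    (c := 32) (by omega)
    (fun N' hN' a F h ha hF => by
      have := (H N' hN' 3 3 a F le_rfl (by omega) (by norm_num) h ha hF).1
      norm_num at this ⊢
      exact this)
    (fun N' hN' τ hτ hτ' a F h hF => by
      obtain rfl : τ = 3 + 3 := by omega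
      refine (dens_le_mul_pow (r := 3) (t₀ := 3) (M := N) (c := 1 / 2 ^ 3)
        (β := 61804 / 100000) (by omega) (by positivity) (by positivity) (by norm_num)
        (fun N hN a F h hF => (ShiftedBound.dens_le_of_le H hN le_rfl (by norm_num) h hF).1)
        hN' h hF).trans ?_
      norm_num)
    (fun N' hN' a F h ha hF => by
      refine (dens_le_half h (hF.of_le (by norm_num))).trans ?_
      norm_num)
    le_rfl le_rfl h hF (h.unionBounded_of_pair (k := 2) ha hF hpair) hpair
  refine hb.trans_lt ?_
  have : q = 0 ∨ q = 1 := by omega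
  rcases this with rfl | rfl <;> norm_num

/-! ### The dense case for `r = t = 3` -/

/-- The constant is just above `(7 / 2 ^ 6 + β ^ 3 / 8) / 2` for the decay rate `β ≈ 0.618034` that
solves `1 + β ^ 3 = 2 β`: the two terms bound the sets without and with the least element. -/
lemma ShiftedBound.dens_le_four {M : ℕ} (H : ∀ N ≤ M, ShiftedBound N) {N a : ℕ}
    {F : Finset (Finset ℕ)} (hN : N ≤ M) (h : IsShifted a N F) (hF : UnionBounded F 3 N 4) :
    dens F N ≤ 139 / 2000 := by
  rcases N with _ | N
  · rw [hF.eq_empty h (by norm_num), dens_empty]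
    norm_num
  rw [dens_split F a N]
  by_cases ha : {a} ∈ F
  · have hN := h.add_le ha hF
    have h0 := (H N (by omega) 3 3 (a + 1) _ le_rfl (by norm_num) (by norm_num) h.lower (by
      rw [mem_nonMemberSubfamily]
      exact ⟨h.singleton_mem ha (by omega) (by omega), by simp⟩) hF.lower).1
    have h1 := dens_le_mul_pow (r := 3) (t₀ := 3) (M := N) (c := 1 / 2 ^ 3) (d := 3)
      (β := 61804 / 100000) (by norm_num) (by positivity) (by positivity) (by norm_num)
      (fun N' hN a F h hF => (ShiftedBound.dens_le_of_le H (by omega) le_rfl (by norm_num) h hF).1)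
      le_rfl h.upper (h.unionBounded_upper (k := 2) hF)
    norm_num at h0 h1
    linarith
  · have h0 := (ShiftedBound.dens_le_of_le H (t := 3) (by omega) le_rfl (by norm_num) h.lower
      (hF.lower)).1
    have h1 : F.memberSubfamily a = ∅ := by
      refine eq_empty_of_forall_notMem fun A hA => ha ?_
      rw [mem_memberSubfamily] at hA
      exact h.down _ hA.1 _ (by simp)
    rw [h1, dens_empty]
    norm_num at h0
    linarith

/-- The one case in which the sets avoiding the `t` least elements can have density almost `1 / 2`,
because only pairs of them are restricted. The Efron–Stein estimate shows that then the sets with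
exactly one element among the `t` least ones are rare. -/
lemma ShiftedBound.dense_of_three_three {N a : ℕ} {F : Finset (Finset ℕ)}
    (H : ∀ N' ≤ N, ShiftedBound N') (h : IsShifted a (N + 1) F) (ha : {a} ∈ F)
    (hF : UnionBounded F 3 (N + 1) 3) (hpair : {a, a + 3} ∈ F) :
    dens F (N + 1) < (3 + 3 + 1) / 2 ^ (3 + 3) := by
  have hN := h.add_le ha hF
  obtain ⟨n, rfl⟩ : ∃ n, N = n + 2 := ⟨N - 2, by omega⟩
  have hF' : UnionBounded F 2 (n + 2 + 1) 5 := h.unionBounded_of_pair (k := 2) (t := 2) ha hF hpair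
  -- indices record the trace on the least elements: `1` for an element of the set, `0` otherwise;
  -- `C` belongs to the trace `001`
  set F0 := F.nonMemberSubfamily a with hF0
  set F1 := F.memberSubfamily a with hF1
  set F00 := F0.nonMemberSubfamily (a + 1) with hF00
  set F01 := F0.memberSubfamily (a + 1) with hF01
  set F10 := F1.nonMemberSubfamily (a + 1) with hF10
  set F11 := F1.memberSubfamily (a + 1) with hF11
  set C := F00.memberSubfamily (a + 2) with hC
  have s0 : IsShifted (a + 1) (n + 2) F0 := h.lower
  have s1 : IsShifted (a + 1) (n + 2) F1 := h.upper
  have s00 : IsShifted (a + 2) (n + 1) F00 := s0.lower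
  have s01 : IsShifted (a + 2) (n + 1) F01 := s0.upper
  have s10 : IsShifted (a + 2) (n + 1) F10 := s1.lower
  have s11 : IsShifted (a + 2) (n + 1) F11 := s1.upper
  have sA : IsShifted (a + 3) n (F00.nonMemberSubfamily (a + 2)) := s00.lower
  have sC : IsShifted (a + 3) n C := s00.upper
  have u0 : UnionBounded F0 3 (n + 2) 2 := hF.lower
  have u1 : UnionBounded F1 3 (n + 2) 5 := h.unionBounded_upper (k := 2) hF
  have u00 : UnionBounded F00 3 (n + 1) 1 := u0.lower
  have u01 : UnionBounded F01 3 (n + 1) 4 := s0.unionBounded_upper (k := 2) u0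
  have u10 : UnionBounded F10 3 (n + 1) 4 := u1.lower
  have u11 : UnionBounded F11 3 (n + 1) 7 := s1.unionBounded_upper (k := 2) u1
  have uA : UnionBounded (F00.nonMemberSubfamily (a + 2)) 2 n 2 := hF'.lower.lower.lower
  have uC : UnionBounded C 3 n 3 := s00.unionBounded_upper (k := 2) u00
  have hdecay : ∀ {d b : ℕ} {G : Finset (Finset ℕ)}, IsShifted b n G → UnionBounded G 3 n (4 + d) →
      dens G n ≤ 139 / 2000 * (61804 / 100000) ^ d := fun hG hGd =>
    dens_le_mul_pow (r := 3) (M := n + 2) (by norm_num) (by norm_num) (by norm_num) (by norm_num)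
      (fun N hN a F h hF => ShiftedBound.dens_le_four H hN h hF) (by omega) hG hGd
  have d011 : dens (F01.memberSubfamily (a + 2)) n ≤ _ :=
    hdecay (d := 2) s01.upper (s01.unionBounded_upper (k := 2) u01)
  have d101 : dens (F10.memberSubfamily (a + 2)) n ≤ _ :=
    hdecay (d := 2) s10.upper (s10.unionBounded_upper (k := 2) u10)
  have d110 : dens (F11.nonMemberSubfamily (a + 2)) n ≤ _ := hdecay (d := 2) s11.lower u11.lower
  have d111 : dens (F11.memberSubfamily (a + 2)) n ≤ _ :=
    hdecay (d := 5) s11.upper (s11.unionBounded_upper (k := 2) u11)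
  have d010 : dens (F01.nonMemberSubfamily (a + 2)) n ≤ dens C n :=
    dens_mono (s0.upper_lower_subset_lower_upper (by omega)) n
  have d100 : dens (F10.nonMemberSubfamily (a + 2)) n ≤ dens C n :=
    (dens_mono (filter_subset_filter _ (h.upper_lower_subset_lower_upper (by omega))) n).trans d010
  have hCa : {a + 3} ∈ C := by
    simp only [hC, hF00, hF0, mem_memberSubfamily, mem_nonMemberSubfamily]
    refine ⟨⟨⟨h.pair_mem hpair (by omega) le_rfl (by omega) (by omega) (by omega), ?_⟩, ?_⟩, ?_⟩ <;>
      simp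
  have dC := (H n (by omega) 3 3 (a + 3) C le_rfl (by norm_num) (by norm_num) sC hCa uC).1
  have dA := dens_le_half sA (uA.of_le (by norm_num))
  have hsum : dens F (n + 2 + 1) = (dens (F00.nonMemberSubfamily (a + 2)) n + dens C n +
      dens (F01.nonMemberSubfamily (a + 2)) n + dens (F01.memberSubfamily (a + 2)) n +
      dens (F10.nonMemberSubfamily (a + 2)) n + dens (F10.memberSubfamily (a + 2)) n +
      dens (F11.nonMemberSubfamily (a + 2)) n + dens (F11.memberSubfamily (a + 2)) n) / 8 := by
    have e := dens_split F a (n + 2)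
    have e0 := dens_split F0 (a + 1) (n + 1)
    have e1 := dens_split F1 (a + 1) (n + 1)
    have e00 := dens_split F00 (a + 2) n
    have e01 := dens_split F01 (a + 2) n
    have e10 := dens_split F10 (a + 2) n
    have e11 := dens_split F11 (a + 2) n
    linarith
  rw [hsum]
  norm_num at d011 d101 d110 d111 dC
  by_cases hP : ∀ j < 4, progression (a + 3) n (4 + j) ∈ C
  · have hsing := sC.singletons hCa
    have dA' := dens_lt_of_blocks (by omega) sA (S := C) (fun B hB A hA A' hA' hcov => by
      simp only [hC, hF00, hF0, mem_memberSubfamily, mem_nonMemberSubfamily] at hB hA hA'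
      have h1 := hF _ ⟨A, hA.1.1.1, _, ⟨A', hA'.1.1.1, _, ⟨_, hB.1.1.1, ∅, rfl, rfl⟩, rfl⟩, rfl⟩
      have h2 := card_le_card (s := insert (a + 2) (Ico (a + 3) (a + 3 + n)))
        (t := A ∪ (A' ∪ (insert (a + 2) B ∪ ∅))) fun z hz => by
          rcases mem_insert.1 hz with rfl | hz
          · simp
          · have := hcov hz
            simp only [mem_union, mem_insert] at this ⊢
            tauto
      rw [card_insert_of_notMem (by simp), Nat.card_Ico] at h2
      omega)
      (hsing _ (mem_Ico.2 (by omega))) (hsing _ (mem_Ico.2 (by omega)))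
      (hsing _ (mem_Ico.2 (by omega))) hP
    norm_num
    linarith
  · push Not at hP
    obtain ⟨j, -, hj⟩ := hP
    -- `0.544` is just above the root `≈ 0.5437` of `1 + β ^ 4 = 2 β`
    have h1 := dens_le_pow_of_progression_notMem (β := 544 / 1000) (by norm_num) (by norm_num) sC hj
    have h2 : (544 / 1000 : ℚ) ^ (4 + j) ≤ (544 / 1000) ^ 4 :=
      pow_le_pow_of_le_one (by norm_num) (by norm_num) (by omega)
    norm_num at h1 h2 ⊢
    linarith

/-! ### The bound for shifted families -/

theorem shiftedBound (N : ℕ) : ShiftedBound N := by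
  induction N using Nat.strong_induction_on with
  | _ N ih =>
    intro r t a F hr ht hrt h ha hF
    have hpos := h.pos ha
    obtain ⟨N, rfl⟩ : ∃ n, N = n + 1 := ⟨N - 1, by omega⟩
    have H : ∀ N' ≤ N, ShiftedBound N' := fun N' hN' => ih N' (by omega)
    by_cases hpair : {a, a + t} ∈ F
    · have hlt : dens F (N + 1) < (r + t + 1) / 2 ^ (r + t) := by
        rcases hr.eq_or_lt with rfl | hr4
        · have : t ≤ 3 := by omega
          rcases this.eq_or_lt with rfl | ht3
          · exact ShiftedBound.dense_of_three_three H h ha hF hpair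
          · exact ShiftedBound.dense_of_three H ht (by omega) h ha hF hpair
        · exact ShiftedBound.dense_of_four_le H hr4 ht hrt h ha hF hpair
      exact ⟨hlt.le, fun heq => absurd heq hlt.ne⟩
    · exact ShiftedBound.sparse H hr ht hrt h ha hF hpair

lemma add_three_le_two_pow {r : ℕ} (hr : 3 ≤ r) : r + 1 + 2 ≤ 2 ^ r := by
  have := two_mul_add_one_le hr
  omega

/-- The bound without a condition on singletons, for families in which also fewer sets miss
accordingly more points. If the first `a` elements lie in no member, the family lives on `n - a`
points, and a smaller number of sets in place of `r` yields the bound for `r + t - a`. -/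
theorem IsShifted.dens_le {n r t : ℕ} {F : Finset (Finset ℕ)} (h : IsShifted 0 n F)
    (hr : 3 ≤ r) (ht : 1 ≤ t) (hrt : r + t + 2 ≤ 2 ^ r)
    (hF : ∀ k, 2 ≤ k → k ≤ r → UnionBounded F k n (r + t - k)) :
    dens F n ≤ (r + t + 1) / 2 ^ (r + t) ∧
    (dens F n = (r + t + 1) / 2 ^ (r + t) →
      r + t ≤ n ∧ F = atMostOne (Ico 0 n) (Ico 0 (r + t))) := by
  have hpos : (0 : ℚ) < 2 ^ (r + t) := by positivity
  have hs4 : (4 : ℚ) < r + t + 1 := by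
    have : 4 < r + t + 1 := by omega
    exact_mod_cast this
  have hof_lt : dens F n < (r + t + 1) / 2 ^ (r + t) → dens F n ≤ (r + t + 1) / 2 ^ (r + t) ∧
      (dens F n = (r + t + 1) / 2 ^ (r + t) →
        r + t ≤ n ∧ F = atMostOne (Ico 0 n) (Ico 0 (r + t))) :=
    fun hlt => ⟨hlt.le, fun heq => absurd heq hlt.ne⟩
  rcases F.eq_empty_or_nonempty with rfl | hne
  · apply hof_lt
    rw [dens_empty]
    positivity
  have hemp := h.empty_mem hne
  have hn : r + t ≤ n + 2 := by
    have := hF 2 le_rfl (by omega) ∅ (unionOf_empty hemp 2)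
    rw [card_empty] at this
    omega
  -- a family on at most `n - (r + t) + 2` points is small enough
  have htriv : ∀ m, r + t ≤ m + 2 → m ≤ n → (∀ A ∈ F, ∀ x ∈ A, m ≤ x) →
      dens F n < (r + t + 1) / 2 ^ (r + t) := by
    intro m hm hmn hFm
    have h1 := (h.shrink hmn (by simpa using hFm)).dens_le_one
    rw [dens_shrink F hmn, div_lt_div_iff₀ (by positivity) hpos]
    have h2 : (2 : ℚ) ^ (r + t) ≤ 2 ^ (m + 2) := pow_le_pow_right₀ (by norm_num) hm
    rw [pow_add (2 : ℚ) m 2] at h2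
    have h3 : (0 : ℚ) < 2 ^ m := by positivity
    nlinarith
  by_cases hex : ∃ a, {a} ∈ F
  swap
  · exact hof_lt (htriv n hn le_rfl fun A hA x hx =>
      absurd ⟨x, h.down A hA _ (singleton_subset_iff.2 hx)⟩ hex)
  have hFa : ∀ A ∈ F, ∀ x ∈ A, Nat.find hex ≤ x := fun A hA x hx =>
    Nat.find_min' hex (h.down A hA _ (singleton_subset_iff.2 hx))
  have ha := Nat.find_spec hex
  set a := Nat.find hex with ha_def
  have han := h.pos ha
  have hsh : IsShifted a (n - a) F := by
    simpa using h.shrink (m := a) (by omega) (by simpa using hFa)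
  have hub : ∀ k, 2 ≤ k → k ≤ r → k + a ≤ r + t → UnionBounded F k (n - a) (r + t - a - k) := by
    intro k hk hkr hka U hU
    have := hF k hk hkr U hU
    omega
  rcases Nat.eq_zero_or_pos a with ha0 | ha0
  · have hFr : UnionBounded F r n t := by simpa using hF r (by omega) le_rfl
    obtain ⟨u, rfl⟩ : ∃ u, t = u + 1 := ⟨t - 1, by omega⟩
    have hle := h.add_le (ha0 ▸ ha) hFr
    have := shiftedBound n r (u + 1) 0 F hr ht hrt h (ha0 ▸ ha) hFr
    simpa [hle] using this
  · apply hof_lt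
    rcases Nat.lt_or_ge (r + t) (a + 3) with hlt | hge
    · exact htriv a (by omega) (by omega) hFa
    -- now the family is a family on `n - a` points with parameter `r + t - a ≥ 3`
    have key : dens F (n - a) ≤ ((r + t - a : ℕ) + 1) / 2 ^ (r + t - a) := by
      rcases hge.eq_or_lt with heq | hlt
      · have := dens_le_half hsh (by
          have := hub 2 le_rfl (by omega) (by omega)
          rwa [show r + t - a - 2 = 1 by omega] at this)
        rw [show r + t - a = 3 by omega]
        norm_num
        linarith
      · have hk3 : 3 ≤ min r (r + t - a - 1) := by omega
        have := (shiftedBound (n - a) (min r (r + t - a - 1)) (r + t - a - min r (r + t - a - 1))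
          a F hk3 (by omega) (by
            rcases le_total r (r + t - a - 1) with hle | hle
            · rw [min_eq_left hle]; omega
            · rw [min_eq_right hle] at hk3 ⊢
              have := add_three_le_two_pow hk3
              omega) hsh ha (hub _ (by omega) (by omega) (by omega))).1
        have e : min r (r + t - a - 1) + (r + t - a - min r (r + t - a - 1)) = r + t - a := by omega
        rw [e, ← Nat.cast_add, e] at this
        exact this
    rw [dens_shrink F (show a ≤ n by omega), div_lt_div_iff₀ (by positivity) hpos]
    rw [le_div_iff₀ (by positivity)] at key
    have e : (2 : ℚ) ^ (r + t) = 2 ^ (r + t - a) * 2 ^ a := by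
      rw [← pow_add, Nat.sub_add_cancel (by omega)]
    rw [e, ← mul_assoc]
    have hcast : ((r + t - a : ℕ) : ℚ) + 1 < r + t + 1 := by
      have : r + t - a + 1 < r + t + 1 := by omega
      exact_mod_cast this
    exact mul_lt_mul_of_pos_right (key.trans_lt hcast) (by positivity)

/-! ### Compressions -/

variable {n : ℕ}

/-- The compression of `F` along an involution `σ` that exchanges the sets satisfying `hi` with
those satisfying `lo`: a member satisfying `hi` is replaced by its partner unless the partner is
a member as well. -/
def compress (σ : Finset (Fin n) → Finset (Fin n)) (hi lo : Finset (Fin n) → Prop)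
    [DecidablePred hi] [DecidablePred lo] (F : Finset (Finset (Fin n))) :
    Finset (Finset (Fin n)) :=
  univ.filter fun A =>
    if hi A then A ∈ F ∧ σ A ∈ F else if lo A then A ∈ F ∨ σ A ∈ F else A ∈ F

section

variable {σ : Finset (Fin n) → Finset (Fin n)} {hi lo : Finset (Fin n) → Prop}
  [DecidablePred hi] [DecidablePred lo]

lemma image_sdiff_compress (hσ : ∀ A, σ (σ A) = A) (h1 : ∀ A, hi A → lo (σ A))
    (h2 : ∀ A, lo A → hi (σ A)) (h3 : ∀ A, hi A → ¬ lo A) (F : Finset (Finset (Fin n))) :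
    (F \ compress σ hi lo F).image σ = compress σ hi lo F \ F := by
  ext A
  simp only [mem_image, mem_sdiff, compress, mem_filter, mem_univ, true_and]
  constructor
  · rintro ⟨B, ⟨hBF, hB⟩, rfl⟩
    by_cases hb : hi B
    · have hl := h1 B hb
      have hnh : ¬ hi (σ B) := fun hh => h3 _ hh hl
      simp only [hb, if_true, hBF, true_and] at hB
      simp only [hnh, hl, if_true, if_false, hσ]
      exact ⟨Or.inr hBF, hB⟩
    · by_cases hl : lo B <;> simp [hb, hl, hBF] at hB
  · rintro ⟨hA, hAF⟩
    by_cases hb : hi A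
    · simp [hb, hAF] at hA
    · by_cases hl : lo A
      · simp only [hb, hl, if_true, if_false, hAF, false_or] at hA
        refine ⟨σ A, ⟨hA, ?_⟩, hσ A⟩
        simp [h2 A hl, hσ, hAF]
      · simp [hb, hl, hAF] at hA

lemma sum_compress (hσ : ∀ A, σ (σ A) = A) (h1 : ∀ A, hi A → lo (σ A))
    (h2 : ∀ A, lo A → hi (σ A)) (h3 : ∀ A, hi A → ¬ lo A) (F : Finset (Finset (Fin n)))
    (w : Finset (Fin n) → ℕ) :
    ∑ A ∈ compress σ hi lo F, w A + ∑ A ∈ F \ compress σ hi lo F, w A =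
      ∑ A ∈ F, w A + ∑ A ∈ F \ compress σ hi lo F, w (σ A) := by
  have e1 := sum_inter_add_sum_sdiff F (compress σ hi lo F) w
  have e2 := sum_inter_add_sum_sdiff (compress σ hi lo F) F w
  rw [← image_sdiff_compress hσ h1 h2 h3, sum_image (fun A _ B _ hAB => by
    rw [← hσ A, ← hσ B, hAB]), inter_comm] at e2
  omega

lemma card_compress (hσ : ∀ A, σ (σ A) = A) (h1 : ∀ A, hi A → lo (σ A))
    (h2 : ∀ A, lo A → hi (σ A)) (h3 : ∀ A, hi A → ¬ lo A) (F : Finset (Finset (Fin n))) :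
    (compress σ hi lo F).card = F.card := by
  have := sum_compress hσ h1 h2 h3 F fun _ => 1
  simp only [sum_const, smul_eq_mul, mul_one] at this
  omega

lemma sum_compress_lt (hσ : ∀ A, σ (σ A) = A) (h1 : ∀ A, hi A → lo (σ A))
    (h2 : ∀ A, lo A → hi (σ A)) (h3 : ∀ A, hi A → ¬ lo A) {F : Finset (Finset (Fin n))}
    {w : Finset (Fin n) → ℕ} (hw : ∀ A, hi A → w (σ A) < w A)
    (hne : compress σ hi lo F ≠ F) :
    ∑ A ∈ compress σ hi lo F, w A < ∑ A ∈ F, w A := by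
  have hF : (F \ compress σ hi lo F).Nonempty := by
    by_contra hemp
    rw [not_nonempty_iff_eq_empty, sdiff_eq_empty_iff_subset] at hemp
    exact hne (eq_of_subset_of_card_le hemp (card_compress hσ h1 h2 h3 F).le).symm
  have hlt : ∑ A ∈ F \ compress σ hi lo F, w (σ A) < ∑ A ∈ F \ compress σ hi lo F, w A := by
    refine sum_lt_sum_of_nonempty hF fun A hA => hw A ?_
    simp only [mem_sdiff, compress, mem_filter, mem_univ, true_and] at hA
    by_contra hb
    by_cases hl : lo A <;> simp [hb, hl, hA.1] at hA
  have := sum_compress hσ h1 h2 h3 F w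
  omega

end

/-- Down-compression: delete `x` from the members containing it, where possible. -/
def downCompress (x : Fin n) (F : Finset (Finset (Fin n))) : Finset (Finset (Fin n)) :=
  compress (fun A => symmDiff A {x}) (fun A => x ∈ A) (fun A => x ∉ A) F

/-- Shift: replace `i` by `j` in the members containing `i` but not `j`, where possible. -/
def shiftCompress (i j : Fin n) (F : Finset (Finset (Fin n))) : Finset (Finset (Fin n)) :=
  compress (fun A => A.map (Equiv.swap i j).toEmbedding) (fun A => i ∈ A ∧ j ∉ A)
    (fun A => i ∉ A ∧ j ∈ A) F

lemma symmDiff_singleton_of_mem {x : Fin n} {A : Finset (Fin n)} (hx : x ∈ A) :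
    symmDiff A {x} = A.erase x := by
  ext y
  simp only [mem_symmDiff, mem_singleton, mem_erase]
  by_cases h : y = x
  · subst h; tauto
  · tauto

lemma symmDiff_singleton_of_notMem {x : Fin n} {A : Finset (Fin n)} (hx : x ∉ A) :
    symmDiff A {x} = insert x A := by
  ext y
  simp only [mem_symmDiff, mem_singleton, mem_insert]
  by_cases h : y = x
  · subst h; tauto
  · tauto

lemma mem_downCompress_of_mem {x : Fin n} {F : Finset (Finset (Fin n))} {A : Finset (Fin n)}
    (hx : x ∈ A) : A ∈ downCompress x F ↔ A ∈ F ∧ A.erase x ∈ F := by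
  simp [downCompress, compress, hx, symmDiff_singleton_of_mem hx]

lemma mem_downCompress_of_notMem {x : Fin n} {F : Finset (Finset (Fin n))} {A : Finset (Fin n)}
    (hx : x ∉ A) : A ∈ downCompress x F ↔ A ∈ F ∨ insert x A ∈ F := by
  simp [downCompress, compress, hx, symmDiff_singleton_of_notMem hx]

lemma mem_map_swap {i j y : Fin n} {A : Finset (Fin n)} :
    y ∈ A.map (Equiv.swap i j).toEmbedding ↔ Equiv.swap i j y ∈ A := by
  rw [mem_map_equiv, Equiv.symm_swap]

lemma mem_map_swap_left {i j : Fin n} {A : Finset (Fin n)} :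
    i ∈ A.map (Equiv.swap i j).toEmbedding ↔ j ∈ A := by
  rw [mem_map_swap, Equiv.swap_apply_left]

lemma mem_map_swap_right {i j : Fin n} {A : Finset (Fin n)} :
    j ∈ A.map (Equiv.swap i j).toEmbedding ↔ i ∈ A := by
  rw [mem_map_swap, Equiv.swap_apply_right]

lemma mem_map_swap_of_ne {i j y : Fin n} {A : Finset (Fin n)} (hi : y ≠ i) (hj : y ≠ j) :
    y ∈ A.map (Equiv.swap i j).toEmbedding ↔ y ∈ A := by
  rw [mem_map_swap, Equiv.swap_apply_of_ne_of_ne hi hj]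

lemma map_swap_map_swap (i j : Fin n) (A : Finset (Fin n)) :
    (A.map (Equiv.swap i j).toEmbedding).map (Equiv.swap i j).toEmbedding = A := by
  ext y
  rw [mem_map_swap, mem_map_swap, Equiv.swap_apply_self]

lemma map_swap_eq_self {i j : Fin n} {A : Finset (Fin n)} (h : i ∈ A ↔ j ∈ A) :
    A.map (Equiv.swap i j).toEmbedding = A := by
  ext y
  by_cases hi : y = i
  · subst hi; rw [mem_map_swap_left, h]
  by_cases hj : y = j
  · subst hj; rw [mem_map_swap_right, h]
  exact mem_map_swap_of_ne hi hj

lemma map_swap_insert {i j : Fin n} (hij : i ≠ j) {Q : Finset (Fin n)} (hi : i ∉ Q) (hj : j ∉ Q) :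
    (insert i Q).map (Equiv.swap i j).toEmbedding = insert j Q := by
  ext y
  by_cases hyi : y = i
  · subst hyi; rw [mem_map_swap_left]; simp [hj, hi, hij, hij.symm]
  by_cases hyj : y = j
  · subst hyj; rw [mem_map_swap_right]; simp
  rw [mem_map_swap_of_ne hyi hyj]; simp [hyi, hyj]

lemma map_swap_insert' {i j : Fin n} (hij : i ≠ j) {Q : Finset (Fin n)} (hi : i ∉ Q)
    (hj : j ∉ Q) : (insert j Q).map (Equiv.swap i j).toEmbedding = insert i Q := by
  rw [← map_swap_insert hij hi hj, map_swap_map_swap]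

lemma insert_mem_shiftCompress {i j : Fin n} (hij : i ≠ j) {F : Finset (Finset (Fin n))}
    {Q : Finset (Fin n)} (hi : i ∉ Q) (hj : j ∉ Q) :
    insert i Q ∈ shiftCompress i j F ↔ insert i Q ∈ F ∧ insert j Q ∈ F := by
  simp [shiftCompress, compress, map_swap_insert hij hi hj, hij.symm, hj]

lemma insert_mem_shiftCompress' {i j : Fin n} (hij : i ≠ j) {F : Finset (Finset (Fin n))}
    {Q : Finset (Fin n)} (hi : i ∉ Q) (hj : j ∉ Q) :
    insert j Q ∈ shiftCompress i j F ↔ insert i Q ∈ F ∨ insert j Q ∈ F := by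
  simp [shiftCompress, compress, map_swap_insert' hij hi hj, hij, hi, or_comm]

lemma mem_shiftCompress_of_iff {i j : Fin n} {F : Finset (Finset (Fin n))} {A : Finset (Fin n)}
    (h : i ∈ A ↔ j ∈ A) : A ∈ shiftCompress i j F ↔ A ∈ F := by
  have h1 : ¬ (i ∈ A ∧ j ∉ A) := by tauto
  have h2 : ¬ (i ∉ A ∧ j ∈ A) := by tauto
  simp only [shiftCompress, compress, mem_filter, mem_univ, true_and, if_neg h1, if_neg h2]

/-- The weight of a set, which decreases when elements are deleted or increased. -/
def weight (A : Finset (Fin n)) : ℕ := ∑ x ∈ A, (n - x)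

lemma card_downCompress (x : Fin n) (F : Finset (Finset (Fin n))) :
    (downCompress x F).card = F.card :=
  card_compress (fun A => symmDiff_symmDiff_cancel_right _ _)
    (fun A h => by simp [mem_symmDiff, h]) (fun A h => by simp [mem_symmDiff, h])
    (fun A h => by simp [h]) F

lemma card_shiftCompress (i j : Fin n) (F : Finset (Finset (Fin n))) :
    (shiftCompress i j F).card = F.card :=
  card_compress (fun A => map_swap_map_swap _ _ _)
    (fun A h => by rw [mem_map_swap_left, mem_map_swap_right]; tauto)
    (fun A h => by rw [mem_map_swap_left, mem_map_swap_right]; tauto)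
    (fun A h => by tauto) F

lemma weight_downCompress_lt {x : Fin n} {F : Finset (Finset (Fin n))}
    (hne : downCompress x F ≠ F) :
    ∑ A ∈ downCompress x F, weight A < ∑ A ∈ F, weight A := by
  refine sum_compress_lt (fun A => symmDiff_symmDiff_cancel_right _ _)
    (fun A h => by simp [mem_symmDiff, h]) (fun A h => by simp [mem_symmDiff, h])
    (fun A h => by simp [h]) (fun A h => ?_) hne
  rw [symmDiff_singleton_of_mem h, weight, weight, ← add_sum_erase A _ h]
  have := x.isLt
  omega

lemma weight_shiftCompress_lt {i j : Fin n} (hij : i < j) {F : Finset (Finset (Fin n))}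
    (hne : shiftCompress i j F ≠ F) :
    ∑ A ∈ shiftCompress i j F, weight A < ∑ A ∈ F, weight A := by
  refine sum_compress_lt (fun A => map_swap_map_swap _ _ _)
    (fun A h => by rw [mem_map_swap_left, mem_map_swap_right]; tauto)
    (fun A h => by rw [mem_map_swap_left, mem_map_swap_right]; tauto)
    (fun A h => by tauto) (fun A h => ?_) hne
  have hj : j ∉ A.erase i := fun hj => h.2 (mem_of_mem_erase hj)
  have hA : A.map (Equiv.swap i j).toEmbedding = insert j (A.erase i) := by
    rw [← map_swap_insert hij.ne (notMem_erase i A) hj, insert_erase h.1]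
  rw [hA, weight, weight, sum_insert hj, ← add_sum_erase A _ h.1]
  have : (i : ℕ) < j := hij
  have := j.isLt
  omega

lemma mem_agreementSet {r : ℕ} {G : Fin r → Finset (Fin n)} {x : Fin n} :
    x ∈ agreementSet G ↔ (∀ i, x ∈ G i) ∨ (∀ i, x ∉ G i) := by
  simp [agreementSet]

lemma isAgreeing_downCompress {r t : ℕ} {F : Finset (Finset (Fin n))} (h : IsAgreeing r t F)
    (x : Fin n) : IsAgreeing r t (downCompress x F) := by
  intro G hG
  suffices ∃ H : Fin r → Finset (Fin n), (∀ k, H k ∈ F) ∧ agreementSet H ⊆ agreementSet G by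
    obtain ⟨H, hH, hsub⟩ := this
    exact (h H hH).trans (card_le_card hsub)
  have hex : ∀ k, ∃ B ∈ F, ∀ y ≠ x, (y ∈ B ↔ y ∈ G k) := by
    intro k
    by_cases hx : x ∈ G k
    · exact ⟨G k, ((mem_downCompress_of_mem hx).1 (hG k)).1, fun y _ => Iff.rfl⟩
    · rcases (mem_downCompress_of_notMem hx).1 (hG k) with h | h
      · exact ⟨_, h, fun y _ => Iff.rfl⟩
      · exact ⟨_, h, fun y hy => by simp [hy]⟩
  choose H hH hHG using hex
  by_cases hx : x ∈ agreementSet G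
  · refine ⟨H, hH, fun y hy => ?_⟩
    by_cases hyx : y = x
    · rwa [hyx]
    · simpa only [mem_agreementSet, hHG _ y hyx] using hy
  · rw [mem_agreementSet, not_or] at hx
    push Not at hx
    obtain ⟨⟨l, hl⟩, ⟨k, hk⟩⟩ := hx
    have hkl : k ≠ l := by rintro rfl; exact hl hk
    obtain ⟨hk1, hk2⟩ := (mem_downCompress_of_mem hk).1 (hG k)
    -- both `G k` and `G k \ {x}` are members, so the `k`-th set can be made to differ at `x`
    have key : ∀ B ∈ F, (∀ y ≠ x, (y ∈ B ↔ y ∈ G k)) → (x ∈ B ↔ x ∉ H l) →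
        ∃ H : Fin r → Finset (Fin n), (∀ k, H k ∈ F) ∧ agreementSet H ⊆ agreementSet G := by
      intro B hB hBG hBx
      refine ⟨Function.update H k B, fun m => ?_, fun y hy => ?_⟩
      · by_cases hm : m = k
        · subst hm; simpa using hB
        · simpa [hm] using hH m
      · by_cases hyx : y = x
        · subst hyx
          rw [mem_agreementSet] at hy
          exfalso
          rcases hy with hy | hy
          · have h1 := hy k
            have h2 := hy l
            rw [Function.update_self] at h1
            rw [Function.update_of_ne hkl.symm] at h2
            tauto
          · have h1 := hy k
            have h2 := hy l
            rw [Function.update_self] at h1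
            rw [Function.update_of_ne hkl.symm] at h2
            tauto
        · have : ∀ m, y ∈ Function.update H k B m ↔ y ∈ G m := by
            intro m
            by_cases hm : m = k
            · subst hm; rw [Function.update_self, hBG y hyx]
            · rw [Function.update_of_ne hm, hHG m y hyx]
          simpa only [mem_agreementSet, this] using hy
    by_cases hxl : x ∈ H l
    · exact key _ hk2 (fun y hy => by simp [hy]) (by simp [hxl])
    · exact key _ hk1 (fun y _ => Iff.rfl) (by simp [hxl, hk])

lemma isAgreeing_shiftCompress {r t : ℕ} {F : Finset (Finset (Fin n))} (h : IsAgreeing r t F)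
    {i j : Fin n} (hij : i ≠ j) : IsAgreeing r t (shiftCompress i j F) := by
  intro G hG
  have hG' : ∀ k, if i ∈ G k ∧ j ∉ G k then G k ∈ F ∧ (G k).map (Equiv.swap i j).toEmbedding ∈ F
      else if i ∉ G k ∧ j ∈ G k then G k ∈ F ∨ (G k).map (Equiv.swap i j).toEmbedding ∈ F
      else G k ∈ F := fun k => (mem_filter.1 (hG k)).2
  by_cases h1 : ∀ k, G k ∈ F
  · exact h G h1
  by_cases h2 : ∀ k, (G k).map (Equiv.swap i j).toEmbedding ∈ F
  · have e : agreementSet (fun k => (G k).map (Equiv.swap i j).toEmbedding) =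
        (agreementSet G).map (Equiv.swap i j).toEmbedding := by
      ext y
      simp only [mem_agreementSet, mem_map_swap]
    have := h _ h2
    rwa [e, card_map] at this
  -- one set must be shifted back and another one must not: the two disagree on `i` and on `j`
  push Not at h1 h2
  obtain ⟨k, hk⟩ := h1
  obtain ⟨l, hl⟩ := h2
  have hk' := hG' k
  have hl' := hG' l
  have hkl : i ∉ G k ∧ j ∈ G k ∧ (G k).map (Equiv.swap i j).toEmbedding ∈ F := by
    split_ifs at hk' <;> tauto
  have hll : i ∉ G l ∧ j ∈ G l ∧ G l ∈ F := by
    split_ifs at hl' with c1 c2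
    · tauto
    · tauto
    · rw [map_swap_eq_self (by tauto)] at hl
      tauto
  have hne : k ≠ l := by rintro rfl; tauto
  let H : Fin r → Finset (Fin n) := fun m =>
    if G m ∈ F then G m else (G m).map (Equiv.swap i j).toEmbedding
  have hH : ∀ m, H m ∈ F := by
    intro m
    have hm := hG' m
    simp only [H]
    split_ifs with hmF
    · exact hmF
    · split_ifs at hm <;> tauto
  have hHk : H k = (G k).map (Equiv.swap i j).toEmbedding := if_neg hk
  have hHl : H l = G l := if_pos hll.2.2
  refine (h H hH).trans (card_le_card fun y hy => ?_)
  rw [mem_agreementSet] at hy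
  have hyi : y ≠ i := by
    rintro rfl
    rcases hy with hy | hy
    · have := hy l
      rw [hHl] at this
      exact hll.1 this
    · have := hy k
      rw [hHk, mem_map_swap_left] at this
      exact this hkl.2.1
  have hyj : y ≠ j := by
    rintro rfl
    rcases hy with hy | hy
    · have := hy k
      rw [hHk, mem_map_swap_right] at this
      exact hkl.1 this
    · have := hy l
      rw [hHl] at this
      exact this hll.2.1
  have : ∀ m, y ∈ H m ↔ y ∈ G m := by
    intro m
    simp only [H]
    split_ifs
    · rfl
    · exact mem_map_swap_of_ne hyi hyj
  simpa only [mem_agreementSet, this] using hy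

/-- Shifts preserve down-sets. -/
lemma erase_mem_shiftCompress {F : Finset (Finset (Fin n))} {i j : Fin n} (hij : i ≠ j)
    (hF : ∀ A ∈ F, ∀ x ∈ A, A.erase x ∈ F) :
    ∀ A ∈ shiftCompress i j F, ∀ x ∈ A, A.erase x ∈ shiftCompress i j F := by
  have hins : ∀ {y : Fin n} {Q : Finset (Fin n)}, insert y Q ∈ F → Q ∈ F := by
    intro y Q h
    by_cases hy : y ∈ Q
    · rwa [insert_eq_of_mem hy] at h
    · simpa [hy] using hF _ h y (mem_insert_self _ _)
  intro A hA x hx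
  by_cases hi : i ∈ A <;> by_cases hj : j ∈ A
  · rw [mem_shiftCompress_of_iff (by tauto)] at hA
    by_cases hxi : x = i
    · subst hxi
      obtain ⟨Q, hQ⟩ : ∃ Q, Q = (A.erase x).erase j := ⟨_, rfl⟩
      have hQj : insert j Q = A.erase x := by rw [hQ, insert_erase]; simp [hij.symm, hj]
      rw [← hQj, insert_mem_shiftCompress' hij (by simp [hQ]) (by simp [hQ]), hQj]
      exact Or.inr (hF A hA x hx)
    · by_cases hxj : x = j
      · subst hxj
        obtain ⟨Q, hQ⟩ : ∃ Q, Q = (A.erase x).erase i := ⟨_, rfl⟩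
        have hQi : insert i Q = A.erase x := by rw [hQ, insert_erase]; simp [hij, hi]
        have hQj : insert x Q = A.erase i := by
          rw [hQ, erase_right_comm, insert_erase]; simp [hij.symm, hj]
        rw [← hQi, insert_mem_shiftCompress hij (by simp [hQ]) (by simp [hQ]), hQi, hQj]
        exact ⟨hF A hA x hx, hF A hA i hi⟩
      · rw [mem_shiftCompress_of_iff (by simp [Ne.symm hxi, Ne.symm hxj, hi, hj])]
        exact hF A hA x hx
  · obtain ⟨Q, hQ⟩ : ∃ Q, Q = A.erase i := ⟨_, rfl⟩
    obtain rfl : A = insert i Q := by rw [hQ, insert_erase hi]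
    have hiQ : i ∉ Q := by rw [hQ]; simp
    have hjQ : j ∉ Q := by simp at hj; tauto
    rw [insert_mem_shiftCompress hij hiQ hjQ] at hA
    by_cases hxi : x = i
    · subst hxi
      rw [erase_insert hiQ, mem_shiftCompress_of_iff (by tauto)]
      exact hins hA.1
    · have hxj : x ≠ j := by rintro rfl; exact hj hx
      rw [erase_insert_of_ne (Ne.symm hxi), insert_mem_shiftCompress hij (by simp [hiQ])
        (by simp [hjQ]), ← erase_insert_of_ne (Ne.symm hxi), ← erase_insert_of_ne (Ne.symm hxj)]
      have hxQ : x ∈ Q := by simpa [hxi] using hx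
      exact ⟨hF _ hA.1 x hx, hF _ hA.2 x (by simp [hxQ])⟩
  · obtain ⟨Q, hQ⟩ : ∃ Q, Q = A.erase j := ⟨_, rfl⟩
    obtain rfl : A = insert j Q := by rw [hQ, insert_erase hj]
    have hjQ : j ∉ Q := by rw [hQ]; simp
    have hiQ : i ∉ Q := by simp at hi; tauto
    rw [insert_mem_shiftCompress' hij hiQ hjQ] at hA
    by_cases hxj : x = j
    · subst hxj
      rw [erase_insert hjQ, mem_shiftCompress_of_iff (by tauto)]
      exact hA.elim hins hins
    · have hxi : x ≠ i := by rintro rfl; exact hi hx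
      have hxQ : x ∈ Q := by simpa [hxj] using hx
      rw [erase_insert_of_ne (Ne.symm hxj), insert_mem_shiftCompress' hij (by simp [hiQ])
        (by simp [hjQ]), ← erase_insert_of_ne (Ne.symm hxi), ← erase_insert_of_ne (Ne.symm hxj)]
      exact hA.imp (fun h => hF _ h x (by simp [hxQ])) (fun h => hF _ h x (by simp [hxQ]))
  · rw [mem_shiftCompress_of_iff (by tauto)] at hA
    rw [mem_shiftCompress_of_iff (by simp [hi, hj])]
    exact hF A hA x hx

/-! ### Undoing a compression of an extremal family -/

lemma mem_flippedFamily {A R B : Finset (Fin n)} :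
    B ∈ flippedFamily A R ↔ (symmDiff B R ∩ A).card ≤ 1 := by
  simp only [flippedFamily, mem_image, mem_filter, mem_univ, true_and]
  constructor
  · rintro ⟨C, hC, rfl⟩
    rwa [symmDiff_symmDiff_cancel_right]
  · exact fun h => ⟨_, h, symmDiff_symmDiff_cancel_right _ _⟩

lemma mem_flippedFamily_empty {A B : Finset (Fin n)} :
    B ∈ flippedFamily A ∅ ↔ (B ∩ A).card ≤ 1 := by
  rw [mem_flippedFamily, ← bot_eq_empty, symmDiff_bot]

lemma card_le_of_three {m : ℕ} {F : Finset (Finset (Fin n))} (h : IsAgreeing 3 m F)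
    {B₁ B₂ B₃ W : Finset (Fin n)} (h₁ : B₁ ∈ F) (h₂ : B₂ ∈ F) (h₃ : B₃ ∈ F)
    (hW : ∀ y, (y ∈ B₁ ↔ y ∈ B₂) → (y ∈ B₁ ↔ y ∈ B₃) → y ∈ W) : m ≤ W.card := by
  refine (h ![B₁, B₂, B₃] fun i => ?_).trans (card_le_card fun y hy => ?_)
  · fin_cases i <;> assumption
  · rw [mem_agreementSet, Fin.forall_fin_succ, Fin.forall_fin_succ, Fin.forall_fin_succ,
      Fin.forall_fin_succ, Fin.forall_fin_succ, Fin.forall_fin_succ] at hy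
    have h1 : ![B₁, B₂, B₃] (Fin.succ 0) = B₂ := rfl
    have h2 : ![B₁, B₂, B₃] (Fin.succ (Fin.succ 0)) = B₃ := rfl
    have h0 : ![B₁, B₂, B₃] 0 = B₁ := rfl
    rw [h0, h1, h2] at hy
    exact hW y (by tauto) (by tauto)

lemma exists_mem_erase_ne_ne {A : Finset (Fin n)} (hA : 4 ≤ A.card) (x a b : Fin n) :
    ∃ c ∈ A, c ≠ x ∧ c ≠ a ∧ c ≠ b := by
  have h : ({x, a, b} : Finset (Fin n)).card < A.card :=
    lt_of_le_of_lt card_le_three (by omega)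
  obtain ⟨c, hc, hc'⟩ := exists_mem_notMem_of_card_lt_card h
  simp only [mem_insert, mem_singleton, not_or] at hc'
  exact ⟨c, hc, hc'⟩

lemma card_sdiff_four {A : Finset (Fin n)} {x a b c : Fin n} (hx : x ∈ A) (ha : a ∈ A)
    (hb : b ∈ A) (hc : c ∈ A) (hax : a ≠ x) (hbx : b ≠ x) (hab : a ≠ b) (hcx : c ≠ x)
    (hca : c ≠ a) (hcb : c ≠ b) : (A \ {x, a, b, c}).card + 4 = A.card := by
  have h4 : ({x, a, b, c} : Finset (Fin n)).card = 4 := by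
    rw [card_insert_of_notMem, card_insert_of_notMem, card_insert_of_notMem, card_singleton] <;>
      simp [hax.symm, hbx.symm, hcx.symm, hab, hca.symm, hcb.symm]
  rw [← h4]
  refine card_sdiff_add_card_eq_card fun y hy => ?_
  simp only [mem_insert, mem_singleton] at hy
  rcases hy with rfl | rfl | rfl | rfl <;> assumption

lemma card_symmDiff_insert_inter {A R C : Finset (Fin n)} {x : Fin n} (hxA : x ∈ A) (hxR : x ∉ R)
    (hxC : x ∉ C) : (symmDiff (insert x C) R ∩ A).card = (symmDiff C R ∩ A).card + 1 := by
  rw [← card_insert_of_notMem (a := x) (s := symmDiff C R ∩ A) (by simp [mem_symmDiff, hxC, hxR])]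
  congr 1
  ext y
  by_cases h : y = x
  · subst h; simp [mem_symmDiff, hxR, hxA]
  · simp [mem_symmDiff, h]

lemma symmDiff_insert_insert {R C : Finset (Fin n)} {x : Fin n} (hxR : x ∉ R)
    (hxC : x ∉ C) : symmDiff (insert x C) (insert x R) = symmDiff C R := by
  ext y
  by_cases h : y = x
  · subst h; simp [mem_symmDiff, hxR, hxC]
  · simp [mem_symmDiff, h]

lemma symmDiff_inter_eq_singleton {A R C : Finset (Fin n)} {a : Fin n}
    (h : symmDiff C R ∩ A = {a}) {y : Fin n} (hy : y ∈ A) : y = a ↔ ¬ (y ∈ C ↔ y ∈ R) := by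
  have := congrArg (y ∈ ·) h
  simp only [mem_inter, mem_symmDiff, mem_singleton, eq_iff_iff] at this
  tauto

/-- If the down-compression of a `3`-wise agreeing family is extremal, so is the family. When a
set `C ∌ x` differs from `R` on `A` in exactly one place, just one of `C`, `C ∪ {x}` is a member;
three members agreeing in too few places would arise if this choice were not always the same. -/
lemma exists_eq_flippedFamily_of_downCompress {F : Finset (Finset (Fin n))}
    {A R : Finset (Fin n)} {x : Fin n} (hF : IsAgreeing 3 (A.card - 3) F) (hA : 4 ≤ A.card)
    (hR : R ⊆ A) (hE : downCompress x F = flippedFamily A R) :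
    ∃ R' ⊆ A, F = flippedFamily A R' := by
  have hor : ∀ C, x ∉ C → (C ∈ F ∨ insert x C ∈ F ↔ (symmDiff C R ∩ A).card ≤ 1) := by
    intro C hC
    rw [← mem_downCompress_of_notMem hC, hE, mem_flippedFamily]
  have hand : ∀ C, x ∉ C →
      (insert x C ∈ F ∧ C ∈ F ↔ (symmDiff (insert x C) R ∩ A).card ≤ 1) := by
    intro C hC
    rw [← mem_flippedFamily, ← hE, mem_downCompress_of_mem (mem_insert_self _ _),
      erase_insert hC]
  by_cases hxA : x ∈ A
  swap
  · refine ⟨R, hR, ?_⟩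
    have hcard : ∀ C, symmDiff (insert x C) R ∩ A = symmDiff C R ∩ A := by
      intro C
      ext y
      by_cases h : y = x
      · subst h; simp [hxA]
      · simp [mem_symmDiff, h]
    ext B
    by_cases hB : x ∈ B
    · have h1 := hor (B.erase x) (notMem_erase _ _)
      have h2 := hand (B.erase x) (notMem_erase _ _)
      rw [← hcard, insert_erase hB] at h1
      rw [insert_erase hB] at h2
      rw [mem_flippedFamily]
      tauto
    · have h1 := hor B hB
      have h2 := hand B hB
      rw [hcard] at h2
      rw [mem_flippedFamily]
      tauto
  have hxR : x ∉ R := by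
    intro hxR
    obtain ⟨z, hz, hzx, -⟩ := exists_mem_erase_ne_ne hA x x x
    have hxB : x ∈ symmDiff R {z} := by simp [mem_symmDiff, hxR, hzx.symm]
    have h1 : symmDiff R {z} ∈ flippedFamily A R := by
      rw [mem_flippedFamily, symmDiff_comm R, symmDiff_symmDiff_cancel_right]
      exact (card_le_card inter_subset_left).trans (card_singleton z).le
    rw [← hE, mem_downCompress_of_mem hxB] at h1
    have h2 := (hor _ (notMem_erase x (symmDiff R {z}))).1 (Or.inl h1.2)
    have hsub : ({x, z} : Finset (Fin n)) ⊆ symmDiff ((symmDiff R {z}).erase x) R ∩ A := by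
      intro y hy
      simp only [mem_insert, mem_singleton] at hy
      rcases hy with rfl | rfl
      · simp [mem_symmDiff, hxR, hxA]
      · simp only [mem_inter, mem_symmDiff, mem_erase, mem_singleton, hz, and_true]
        tauto
    have := card_le_card hsub
    rw [card_pair hzx.symm] at this
    omega
  replace hand : ∀ C, x ∉ C → (insert x C ∈ F ∧ C ∈ F ↔ (symmDiff C R ∩ A).card = 0) := by
    intro C hC
    rw [hand C hC, card_symmDiff_insert_inter hxA hxR hC]
    omega
  have hne : ∀ {C a}, x ∉ C → symmDiff C R ∩ A = {a} → a ∈ A ∧ a ≠ x := by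
    intro C a hC ha
    have h : a ∈ symmDiff C R ∩ A := by rw [ha]; exact mem_singleton_self a
    refine ⟨(mem_inter.1 h).2, ?_⟩
    rintro rfl
    simp [mem_symmDiff, hxR, hC] at h
  have key : ∀ {C₁ C₂ a₁ a₂}, x ∉ C₁ → x ∉ C₂ → symmDiff C₁ R ∩ A = {a₁} →
      symmDiff C₂ R ∩ A = {a₂} → a₁ ≠ a₂ → C₁ ∈ F → insert x C₂ ∈ F → False := by
    intro C₁ C₂ a₁ a₂ hx₁ hx₂ h₁ h₂ h12 hC₁ hC₂
    obtain ⟨ha₁, ha₁x⟩ := hne hx₁ h₁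
    obtain ⟨ha₂, ha₂x⟩ := hne hx₂ h₂
    obtain ⟨c, hc, hcx, hc₁, hc₂⟩ := exists_mem_erase_ne_ne hA x a₁ a₂
    -- the third set is `R ∆ {c}` on `A` and the complement of `C₁` elsewhere
    obtain ⟨C₃, hC₃⟩ : ∃ C₃ : Finset (Fin n), C₃ = univ.filter fun y =>
      if y ∈ A then ¬ (y = c ↔ y ∈ R) else y ∉ C₁ := ⟨_, rfl⟩
    have hin : ∀ y ∈ A, (y ∈ C₃ ↔ ¬ (y = c ↔ y ∈ R)) := by
      intro y hy; simp [hC₃, hy]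
    have hout : ∀ y ∉ A, (y ∈ C₃ ↔ y ∉ C₁) := by
      intro y hy; simp [hC₃, hy]
    have hx₃ : x ∉ C₃ := by rw [hin x hxA]; tauto
    have h₃ : symmDiff C₃ R ∩ A = {c} := by
      ext y
      simp only [mem_inter, mem_symmDiff, mem_singleton]
      by_cases hy : y ∈ A
      · rw [hin y hy]; tauto
      · have : y ≠ c := by rintro rfl; exact hy hc
        tauto
    have hmem := (hor C₃ hx₃).2 (by rw [h₃, card_singleton])
    obtain ⟨G, hG, hGC⟩ : ∃ G ∈ F, ∀ y ≠ x, (y ∈ G ↔ y ∈ C₃) := by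
      rcases hmem with h | h
      · exact ⟨_, h, fun _ _ => Iff.rfl⟩
      · exact ⟨_, h, fun y hy => by simp [hy]⟩
    have hle := card_le_of_three hF hC₁ hC₂ hG (W := A \ {x, a₁, a₂, c}) (by
      intro y hy2 hy3
      have hyx : y ≠ x := by
        rintro rfl
        exact hx₁ (hy2.2 (mem_insert_self _ _))
      have e2 : y ∈ insert x C₂ ↔ y ∈ C₂ := by simp [hyx]
      rw [e2] at hy2
      rw [hGC y hyx] at hy3
      by_cases hyA : y ∈ A
      · have i1 := symmDiff_inter_eq_singleton h₁ hyA
        have i2 := symmDiff_inter_eq_singleton h₂ hyA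
        have i3 := symmDiff_inter_eq_singleton h₃ hyA
        have n1 : y = a₁ → y ≠ a₂ := by rintro rfl; exact h12
        have n2 : y = c → y ≠ a₁ := by rintro rfl; exact hc₁
        have e1 : y ≠ a₁ → (y ∈ C₁ ↔ y ∈ R) := fun h => not_not.1 (mt i1.2 h)
        simp only [mem_sdiff, mem_insert, mem_singleton, not_or]
        exact ⟨hyA, hyx, fun e => i1.1 e (hy2.trans (not_not.1 (mt i2.2 (n1 e)))),
          fun e => i2.1 e (hy2.symm.trans (e1 fun e' => n1 e' e)),
          fun e => i3.1 e (hy3.symm.trans (e1 (n2 e)))⟩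
      · rw [hout y hyA] at hy3
        exact (iff_not_self hy3).elim)
    have := card_sdiff_four hxA ha₁ ha₂ hc ha₁x ha₂x h12 hcx hc₁ hc₂
    omega
  have hone : ∀ {C}, (symmDiff C R ∩ A).card ≤ 1 → (symmDiff C R ∩ A).card ≠ 0 →
      ∃ a, symmDiff C R ∩ A = {a} := fun h h' => card_eq_one.1 (by omega)
  by_cases hall : ∀ C a, x ∉ C → symmDiff C R ∩ A = {a} → C ∈ F
  · refine ⟨R, hR, ?_⟩
    ext B
    rw [mem_flippedFamily]
    by_cases hB : x ∈ B
    · obtain ⟨C, hC, rfl⟩ : ∃ C, x ∉ C ∧ insert x C = B :=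
        ⟨B.erase x, notMem_erase _ _, insert_erase hB⟩
      rw [card_symmDiff_insert_inter hxA hxR hC]
      have h1 := hor C hC
      have h2 := hand C hC
      refine ⟨fun h => ?_, fun h => (h2.2 (by omega)).1⟩
      by_contra h0
      obtain ⟨a, ha⟩ := hone (h1.1 (Or.inr h)) (by omega)
      have := h2.1 ⟨h, hall C a hC ha⟩
      omega
    · refine ⟨fun h => (hor B hB).1 (Or.inl h), fun h => ?_⟩
      by_cases h0 : (symmDiff B R ∩ A).card = 0
      · exact ((hand B hB).2 h0).2
      · obtain ⟨a, ha⟩ := hone h h0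
        exact hall B a hB ha
  · push Not at hall
    obtain ⟨C₀, a₀, hx₀, h₀, hC₀⟩ := hall
    have hC₀' : insert x C₀ ∈ F :=
      ((hor C₀ hx₀).2 (by rw [h₀, card_singleton])).resolve_left hC₀
    have hall : ∀ C a, x ∉ C → symmDiff C R ∩ A = {a} → C ∉ F := by
      intro C a hC ha hCF
      by_cases haa : a = a₀
      · subst haa
        obtain ⟨b, hb, hbx, hba, -⟩ := exists_mem_erase_ne_ne hA x a a
        have hxb : x ∉ symmDiff R {b} := by simp [mem_symmDiff, hxR, hbx.symm]
        have hbs : symmDiff (symmDiff R {b}) R ∩ A = {b} := by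
          rw [symmDiff_comm R, symmDiff_symmDiff_cancel_right]
          exact inter_eq_left.2 (singleton_subset_iff.2 hb)
        rcases (hor _ hxb).2 (by rw [hbs, card_singleton]) with h | h
        · exact key hxb hx₀ hbs h₀ hba h hC₀'
        · exact key hC hxb ha hbs hba.symm hCF h
      · exact key hC hx₀ ha h₀ haa hCF hC₀'
    refine ⟨insert x R, insert_subset hxA hR, ?_⟩
    ext B
    rw [mem_flippedFamily]
    by_cases hB : x ∈ B
    · obtain ⟨C, hC, rfl⟩ : ∃ C, x ∉ C ∧ insert x C = B :=
        ⟨B.erase x, notMem_erase _ _, insert_erase hB⟩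
      rw [symmDiff_insert_insert hxR hC]
      have h1 := hor C hC
      refine ⟨fun h => h1.1 (Or.inr h), fun h => ?_⟩
      by_cases h0 : (symmDiff C R ∩ A).card = 0
      · exact ((hand C hC).2 h0).1
      · obtain ⟨a, ha⟩ := hone h h0
        exact (h1.2 h).resolve_left (hall C a hC ha)
    · rw [symmDiff_comm, card_symmDiff_insert_inter hxA hB hxR, symmDiff_comm]
      have h1 := hor B hB
      have h2 := hand B hB
      refine ⟨fun h => ?_, fun h => (h2.2 (by omega)).2⟩
      by_contra h0
      obtain ⟨a, ha⟩ := hone (h1.1 (Or.inl h)) (by omega)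
      exact hall B a hB ha h

/-- If a shift of a `3`-wise agreeing family is `{B : |B ∩ A| ≤ 1}`, then the family has the same
form. The argument is that for down-compressions, applied to the pairs `Q ∪ {i}`, `Q ∪ {j}`. -/
lemma exists_eq_flippedFamily_of_shiftCompress {F : Finset (Finset (Fin n))}
    {A : Finset (Fin n)} {i j : Fin n} (hij : i ≠ j) (hF : IsAgreeing 3 (A.card - 3) F)
    (hA : 4 ≤ A.card) (hE : shiftCompress i j F = flippedFamily A ∅) :
    ∃ A' : Finset (Fin n), A'.card = A.card ∧ F = flippedFamily A' ∅ := by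
  have hiff : ∀ B, (i ∈ B ↔ j ∈ B) → (B ∈ F ↔ (B ∩ A).card ≤ 1) := by
    intro B hB
    rw [← mem_shiftCompress_of_iff hB, hE, mem_flippedFamily_empty]
  have hand : ∀ Q, i ∉ Q → j ∉ Q →
      (insert i Q ∈ F ∧ insert j Q ∈ F ↔ (insert i Q ∩ A).card ≤ 1) := by
    intro Q hi hj
    rw [← insert_mem_shiftCompress hij hi hj, hE, mem_flippedFamily_empty]
  have hor : ∀ Q, i ∉ Q → j ∉ Q →
      (insert i Q ∈ F ∨ insert j Q ∈ F ↔ (insert j Q ∩ A).card ≤ 1) := by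
    intro Q hi hj
    rw [← insert_mem_shiftCompress' hij hi hj, hE, mem_flippedFamily_empty]
  have hcases : ∀ B : Finset (Fin n), (i ∈ B ↔ j ∈ B) ∨
      (∃ Q, i ∉ Q ∧ j ∉ Q ∧ insert i Q = B) ∨ (∃ Q, i ∉ Q ∧ j ∉ Q ∧ insert j Q = B) := by
    intro B
    by_cases hi : i ∈ B <;> by_cases hj : j ∈ B
    · tauto
    · exact Or.inr (Or.inl ⟨B.erase i, by simp, by simp [hj], insert_erase hi⟩)
    · exact Or.inr (Or.inr ⟨B.erase j, by simp [hi], by simp, insert_erase hj⟩)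
    · tauto
  have hin : ∀ {x Q}, x ∉ Q → x ∈ A → (insert x Q ∩ A).card = (Q ∩ A).card + 1 := by
    intro x Q hx hxA
    rw [insert_inter_of_mem hxA, card_insert_of_notMem (by simp [hx])]
  have hout : ∀ {x Q}, x ∉ A → (insert x Q ∩ A).card = (Q ∩ A).card := by
    intro x Q hxA
    rw [insert_inter_of_notMem hxA]
  by_cases hijA : i ∈ A ↔ j ∈ A
  · refine ⟨A, rfl, ?_⟩
    ext B
    rw [mem_flippedFamily_empty]
    have hcard : ∀ Q, i ∉ Q → j ∉ Q → (insert i Q ∩ A).card = (insert j Q ∩ A).card := by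
      intro Q hi hj
      by_cases hiA : i ∈ A
      · rw [hin hi hiA, hin hj (hijA.1 hiA)]
      · rw [hout hiA, hout (fun h => hiA (hijA.2 h))]
    rcases hcases B with h | ⟨Q, hi, hj, rfl⟩ | ⟨Q, hi, hj, rfl⟩
    · exact hiff B h
    · have h1 := hand Q hi hj
      have h2 := hor Q hi hj
      rw [← hcard Q hi hj] at h2
      tauto
    · have h1 := hand Q hi hj
      have h2 := hor Q hi hj
      rw [hcard Q hi hj] at h1
      tauto
  by_cases hiA : i ∈ A
  swap
  · exfalso
    have hjA : j ∈ A := by tauto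
    obtain ⟨z, hz, hzj, hzi, -⟩ := exists_mem_erase_ne_ne hA j i i
    have hi : i ∉ ({z} : Finset (Fin n)) := by simpa using hzi.symm
    have hj : j ∉ ({z} : Finset (Fin n)) := by simpa using hzj.symm
    have hzA : (({z} : Finset (Fin n)) ∩ A).card = 1 := by simp [hz]
    have h1 := (hand _ hi hj).2 (by rw [hout hiA, hzA])
    have h2 := (hor _ hi hj).1 (Or.inl h1.1)
    rw [hin hj hjA, hzA] at h2
    omega
  have hjA : j ∉ A := by tauto
  replace hand : ∀ Q, i ∉ Q → j ∉ Q →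
      (insert i Q ∈ F ∧ insert j Q ∈ F ↔ (Q ∩ A).card = 0) := by
    intro Q hi hj
    rw [hand Q hi hj, hin hi hiA]
    omega
  replace hor : ∀ Q, i ∉ Q → j ∉ Q →
      (insert i Q ∈ F ∨ insert j Q ∈ F ↔ (Q ∩ A).card ≤ 1) := by
    intro Q hi hj
    rw [hor Q hi hj, hout hjA]
  have hmem : ∀ {Q : Finset (Fin n)} {a}, Q ∩ A = {a} → ∀ {y}, y ∈ A → (y = a ↔ y ∈ Q) := by
    intro Q a h y hy
    have := congrArg (y ∈ ·) h
    simp only [mem_inter, mem_singleton, eq_iff_iff] at this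
    tauto
  have hne : ∀ {Q : Finset (Fin n)} {a}, i ∉ Q → Q ∩ A = {a} → a ∈ A ∧ a ≠ i := by
    intro Q a hi ha
    have h : a ∈ Q ∩ A := by rw [ha]; exact mem_singleton_self a
    refine ⟨(mem_inter.1 h).2, ?_⟩
    rintro rfl
    exact hi (mem_inter.1 h).1
  have key : ∀ {Q₁ Q₂ a₁ a₂}, i ∉ Q₁ → j ∉ Q₁ → i ∉ Q₂ → j ∉ Q₂ → Q₁ ∩ A = {a₁} →
      Q₂ ∩ A = {a₂} → a₁ ≠ a₂ → insert j Q₁ ∈ F → insert i Q₂ ∈ F → False := by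
    intro Q₁ Q₂ a₁ a₂ hi₁ hj₁ hi₂ hj₂ h₁ h₂ h12 hQ₁ hQ₂
    obtain ⟨ha₁, ha₁i⟩ := hne hi₁ h₁
    obtain ⟨ha₂, ha₂i⟩ := hne hi₂ h₂
    obtain ⟨c, hc, hci, hc₁, hc₂⟩ := exists_mem_erase_ne_ne hA i a₁ a₂
    -- the third set is `{c}` on `A` and the complement of `Q₁` elsewhere, except for `i` and `j`
    obtain ⟨Q₃, hQ₃⟩ : ∃ Q₃ : Finset (Fin n), Q₃ = univ.filter fun y =>
      if y ∈ A then y = c else y ≠ j ∧ y ∉ Q₁ := ⟨_, rfl⟩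
    have hinA : ∀ y ∈ A, (y ∈ Q₃ ↔ y = c) := by
      intro y hy; simp [hQ₃, hy]
    have houtA : ∀ y ∉ A, (y ∈ Q₃ ↔ y ≠ j ∧ y ∉ Q₁) := by
      intro y hy; simp [hQ₃, hy]
    have hi₃ : i ∉ Q₃ := by rw [hinA i hiA]; exact hci.symm
    have hj₃ : j ∉ Q₃ := by rw [houtA j hjA]; tauto
    have h₃ : Q₃ ∩ A = {c} := by
      ext y
      simp only [mem_inter, mem_singleton]
      by_cases hy : y ∈ A
      · rw [hinA y hy]; tauto
      · have : y ≠ c := by rintro rfl; exact hy hc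
        tauto
    have hm := (hor Q₃ hi₃ hj₃).2 (by rw [h₃, card_singleton])
    obtain ⟨G, hG, hGQ⟩ : ∃ G ∈ F, ∀ y, y ≠ i → y ≠ j → (y ∈ G ↔ y ∈ Q₃) := by
      rcases hm with h | h
      · exact ⟨_, h, fun y hy _ => by simp [hy]⟩
      · exact ⟨_, h, fun y _ hy => by simp [hy]⟩
    have hle := card_le_of_three hF hQ₁ hQ₂ hG (W := A \ {i, a₁, a₂, c}) (by
      intro y hy2 hy3
      have hyi : y ≠ i := by
        rintro rfl
        simp [hij, hi₁] at hy2
      have hyj : y ≠ j := by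
        rintro rfl
        simp [hij.symm, hj₂] at hy2
      have e1 : y ∈ insert j Q₁ ↔ y ∈ Q₁ := by simp [hyj]
      have e2 : y ∈ insert i Q₂ ↔ y ∈ Q₂ := by simp [hyi]
      rw [e1, e2] at hy2
      rw [e1, hGQ y hyi hyj] at hy3
      by_cases hyA : y ∈ A
      · have i1 := hmem h₁ hyA
        have i2 := hmem h₂ hyA
        have i3 := hmem h₃ hyA
        have n1 : y = a₁ → y ≠ a₂ := by rintro rfl; exact h12
        have n2 : y = c → y ≠ a₁ := by rintro rfl; exact hc₁
        simp only [mem_sdiff, mem_insert, mem_singleton, not_or]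
        exact ⟨hyA, hyi, fun e => n1 e (i2.2 (hy2.1 (i1.1 e))),
          fun e => n1 (i1.2 (hy2.2 (i2.1 e))) e, fun e => n2 e (i1.2 (hy3.2 (i3.1 e)))⟩
      · rw [houtA y hyA, and_iff_right hyj] at hy3
        exact (iff_not_self hy3).elim)
    have := card_sdiff_four hiA ha₁ ha₂ hc ha₁i ha₂i h12 hci hc₁ hc₂
    omega
  have hone : ∀ {Q : Finset (Fin n)}, (Q ∩ A).card ≤ 1 → (Q ∩ A).card ≠ 0 →
      ∃ a, Q ∩ A = {a} := fun h h' => card_eq_one.1 (by omega)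
  by_cases hall : ∀ Q a, i ∉ Q → j ∉ Q → Q ∩ A = {a} → insert j Q ∈ F
  · refine ⟨A, rfl, ?_⟩
    ext B
    rw [mem_flippedFamily_empty]
    rcases hcases B with h | ⟨Q, hi, hj, rfl⟩ | ⟨Q, hi, hj, rfl⟩
    · exact hiff B h
    · rw [hin hi hiA]
      have h1 := hor Q hi hj
      have h2 := hand Q hi hj
      refine ⟨fun h => ?_, fun h => (h2.2 (by omega)).1⟩
      by_contra h0
      obtain ⟨a, ha⟩ := hone (h1.1 (Or.inl h)) (by omega)
      have := h2.1 ⟨h, hall Q a hi hj ha⟩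
      omega
    · rw [hout hjA]
      refine ⟨fun h => (hor Q hi hj).1 (Or.inr h), fun h => ?_⟩
      by_cases h0 : (Q ∩ A).card = 0
      · exact ((hand Q hi hj).2 h0).2
      · obtain ⟨a, ha⟩ := hone h h0
        exact hall Q a hi hj ha
  · push Not at hall
    obtain ⟨Q₀, a₀, hi₀, hj₀, h₀, hQ₀⟩ := hall
    have hQ₀' : insert i Q₀ ∈ F :=
      ((hor Q₀ hi₀ hj₀).2 (by rw [h₀, card_singleton])).resolve_right hQ₀
    have hall : ∀ Q a, i ∉ Q → j ∉ Q → Q ∩ A = {a} → insert j Q ∉ F := by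
      intro Q a hi hj ha hQF
      by_cases haa : a = a₀
      · subst haa
        obtain ⟨b, hb, hbi, hba, hbj⟩ := exists_mem_erase_ne_ne hA i a j
        have hib : i ∉ ({b} : Finset (Fin n)) := by simpa using hbi.symm
        have hjb : j ∉ ({b} : Finset (Fin n)) := by simpa using hbj.symm
        have hbs : {b} ∩ A = {b} := inter_eq_left.2 (singleton_subset_iff.2 hb)
        rcases (hor _ hib hjb).2 (by rw [hbs, card_singleton]) with h | h
        · exact key hi hj hib hjb ha hbs hba.symm hQF h
        · exact key hib hjb hi₀ hj₀ hbs h₀ hba h hQ₀'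
      · exact key hi hj hi₀ hj₀ ha h₀ haa hQF hQ₀'
    have hjE : j ∉ A.erase i := fun h => hjA (mem_of_mem_erase h)
    have hQA : ∀ Q : Finset (Fin n), i ∉ Q → j ∉ Q → Q ∩ insert j (A.erase i) = Q ∩ A := by
      intro Q hi hj
      rw [inter_insert_of_notMem hj, inter_erase, erase_eq_of_notMem (by simp [hi])]
    refine ⟨insert j (A.erase i), ?_, ?_⟩
    · rw [card_insert_of_notMem hjE, card_erase_add_one hiA]
    ext B
    rw [mem_flippedFamily_empty]
    have hiA' : i ∉ insert j (A.erase i) := by simp [hij]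
    have hjA' : j ∈ insert j (A.erase i) := mem_insert_self _ _
    rcases hcases B with h | ⟨Q, hi, hj, rfl⟩ | ⟨Q, hi, hj, rfl⟩
    · rw [hiff B h]
      by_cases hiB : i ∈ B
      · have hjB := h.1 hiB
        obtain ⟨Q, hi, hj, rfl⟩ : ∃ Q, i ∉ Q ∧ j ∉ Q ∧ insert i (insert j Q) = B :=
          ⟨(B.erase i).erase j, by simp, by simp, by
            rw [insert_erase (mem_erase.2 ⟨hij.symm, hjB⟩), insert_erase hiB]⟩
        rw [hin (by simp [hij, hi]) hiA, hout hjA, insert_inter_of_notMem hiA',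
          insert_inter_of_mem hjA', hQA Q hi hj, card_insert_of_notMem (by simp [hj])]
      · rw [hQA B hiB (fun hj => hiB (h.2 hj))]
    · rw [insert_inter_of_notMem hiA', hQA Q hi hj]
      refine ⟨fun h => (hor Q hi hj).1 (Or.inl h), fun h => ?_⟩
      by_cases h0 : (Q ∩ A).card = 0
      · exact ((hand Q hi hj).2 h0).1
      · obtain ⟨a, ha⟩ := hone h h0
        exact ((hor Q hi hj).2 h).resolve_right (hall Q a hi hj ha)
    · rw [insert_inter_of_mem hjA', hQA Q hi hj, card_insert_of_notMem (by simp [hj])]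
      have h1 := hor Q hi hj
      have h2 := hand Q hi hj
      refine ⟨fun h => ?_, fun h => (h2.2 (by omega)).2⟩
      by_contra h0
      obtain ⟨a, ha⟩ := hone (h1.1 (Or.inr h)) (by omega)
      exact hall Q a hi hj ha h

/-- A family `flippedFamily A R` that is a down-set is not flipped at all. -/
lemma eq_empty_of_flippedFamily_erase {A R : Finset (Fin n)} (hA : 2 ≤ A.card) (hR : R ⊆ A)
    (h : ∀ B ∈ flippedFamily A R, ∀ x ∈ B, B.erase x ∈ flippedFamily A R) : R = ∅ := by
  rw [eq_empty_iff_forall_notMem]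
  intro y hy
  obtain ⟨z, hz, hzy⟩ := exists_mem_ne (by omega : 1 < A.card) y
  have hyB : y ∈ symmDiff R {z} := by simp [mem_symmDiff, hy, hzy.symm]
  have h1 := h (symmDiff R {z}) (by
    rw [mem_flippedFamily, symmDiff_comm R, symmDiff_symmDiff_cancel_right]
    exact (card_le_card inter_subset_left).trans (card_singleton z).le) y hyB
  rw [mem_flippedFamily] at h1
  have hsub : ({y, z} : Finset (Fin n)) ⊆ symmDiff ((symmDiff R {z}).erase y) R ∩ A := by
    intro w hw
    simp only [mem_insert, mem_singleton] at hw
    rcases hw with rfl | rfl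
    · simp [mem_symmDiff, hy, hR hy]
    · simp only [mem_inter, mem_symmDiff, mem_erase, mem_singleton, hz, and_true]
      tauto
  have := card_le_card hsub
  rw [card_pair hzy.symm] at this
  omega

/-! ### Reduction to shifted down-sets -/

lemma mem_of_subset_of_erase_mem {F : Finset (Finset (Fin n))}
    (hF : ∀ A ∈ F, ∀ x ∈ A, A.erase x ∈ F) {A : Finset (Fin n)} :
    ∀ {B : Finset (Fin n)}, A ∈ F → B ⊆ A → B ∈ F := by
  induction A using Finset.strongInduction with
  | H A ih =>
    intro B hA hBA
    by_cases hAB : B = A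
    · rwa [hAB]
    · obtain ⟨x, hxA, hxB⟩ := exists_of_ssubset (hBA.ssubset_of_ne hAB)
      exact ih _ (erase_ssubset hxA) (hF A hA x hxA)
        (fun y hy => mem_erase.2 ⟨fun e => hxB (e ▸ hy), hBA hy⟩)

/-- The family `F` on `Fin n` viewed as a family of sets of natural numbers. -/
def toNat (F : Finset (Finset (Fin n))) : Finset (Finset ℕ) :=
  F.map (mapEmbedding Fin.valEmbedding).toEmbedding

lemma mem_toNat {F : Finset (Finset (Fin n))} {B : Finset ℕ} :
    B ∈ toNat F ↔ ∃ A ∈ F, A.map Fin.valEmbedding = B := by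
  simp [toNat, mapEmbedding_apply]

lemma map_val_mem_toNat {F : Finset (Finset (Fin n))} {A : Finset (Fin n)} :
    A.map Fin.valEmbedding ∈ toNat F ↔ A ∈ F := by
  rw [mem_toNat]
  exact ⟨fun ⟨B, hB, h⟩ => map_injective _ h ▸ hB, fun h => ⟨A, h, rfl⟩⟩

lemma card_toNat (F : Finset (Finset (Fin n))) : (toNat F).card = F.card := card_map _

lemma isShifted_toNat {F : Finset (Finset (Fin n))}
    (hdown : ∀ x, downCompress x F = F) (hshift : ∀ i j, i < j → shiftCompress i j F = F) :
    IsShifted 0 n (toNat F) := by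
  have hF : ∀ A ∈ F, ∀ x ∈ A, A.erase x ∈ F := by
    intro A hA x hx
    rw [← hdown x, mem_downCompress_of_mem hx] at hA
    exact hA.2
  refine ⟨fun B hB => ?_, fun B hB C hC => ?_, fun B hB x hx y hxy hy => ?_⟩
  · obtain ⟨A, -, rfl⟩ := mem_toNat.1 hB
    intro y hy
    obtain ⟨z, -, rfl⟩ := mem_map.1 hy
    simp
  · obtain ⟨A, hA, rfl⟩ := mem_toNat.1 hB
    obtain ⟨D, hDA, rfl⟩ := subset_map_iff.1 hC
    exact map_val_mem_toNat.2 (mem_of_subset_of_erase_mem hF hA hDA)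
  · obtain ⟨A, hA, rfl⟩ := mem_toNat.1 hB
    obtain ⟨i, hi, rfl⟩ := mem_map.1 hx
    rw [zero_add] at hy
    obtain ⟨j, rfl⟩ : ∃ j : Fin n, Fin.valEmbedding j = y := ⟨⟨y, hy⟩, rfl⟩
    rw [← map_erase, ← map_insert, map_val_mem_toNat]
    by_cases hj : j ∈ A
    · refine mem_of_subset_of_erase_mem hF hA (insert_subset hj (erase_subset _ _))
    · have hij : i < j := hxy
      rw [← hshift i j hij, ← insert_erase hi,
        insert_mem_shiftCompress hij.ne (notMem_erase _ _) (fun h => hj (mem_of_mem_erase h))]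
        at hA
      exact hA.2

lemma exists_of_unionOf_toNat {F : Finset (Finset (Fin n))} {k : ℕ} {U : Finset ℕ}
    (hU : UnionOf (toNat F) k U) :
    ∃ G : Fin k → Finset (Fin n), (∀ i, G i ∈ F) ∧
      U = (univ.biUnion G).map Fin.valEmbedding := by
  induction k generalizing U with
  | zero => exact ⟨Fin.elim0, fun i => i.elim0, by rw [show U = ∅ from hU]; simp⟩
  | succ k ih =>
    obtain ⟨B, hB, U', hU', rfl⟩ := hU
    obtain ⟨A, hA, rfl⟩ := mem_toNat.1 hB
    obtain ⟨G, hG, rfl⟩ := ih hU'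
    refine ⟨Fin.cons A G, Fin.cases hA hG, ?_⟩
    rw [← map_union]
    congr 1
    ext y
    simp [Fin.exists_fin_succ]

/-- For a down-set, `k`-wise agreeing bounds unions of `k` members: replacing one member by its
difference with another one leaves only the coordinates outside the union to agree on. -/
lemma unionBounded_toNat {F : Finset (Finset (Fin n))}
    (hF : ∀ A ∈ F, ∀ x ∈ A, A.erase x ∈ F) {k t : ℕ} (hk : 2 ≤ k) (h : IsAgreeing k t F) :
    UnionBounded (toNat F) k n t := by
  intro U hU
  obtain ⟨G, hG, rfl⟩ := exists_of_unionOf_toNat hU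
  obtain ⟨k, rfl⟩ := Nat.exists_eq_add_of_le' hk
  have hle := h (Function.update G 0 (G 0 \ G 1)) (fun i => by
    by_cases hi : i = 0
    · subst hi
      rw [Function.update_self]
      exact mem_of_subset_of_erase_mem hF (hG 0) sdiff_subset
    · rw [Function.update_of_ne hi]
      exact hG i)
  have hsub : agreementSet (Function.update G 0 (G 0 \ G 1)) ⊆ (univ.biUnion G)ᶜ := by
    intro y hy
    have h10 : (1 : Fin (k + 2)) ≠ 0 := by simp
    rw [mem_agreementSet] at hy
    rw [mem_compl, mem_biUnion]
    rintro ⟨i, -, hi⟩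
    rcases hy with hy | hy
    · have h0 := hy 0
      have h1 := hy 1
      rw [Function.update_self] at h0
      rw [Function.update_of_ne h10] at h1
      exact (mem_sdiff.1 h0).2 h1
    · have h1 := hy 1
      rw [Function.update_of_ne h10] at h1
      have h0 := hy 0
      rw [Function.update_self, mem_sdiff] at h0
      have hi' := hy i
      by_cases h : i = 0
      · subst h; exact h0 ⟨hi, h1⟩
      · rw [Function.update_of_ne h] at hi'
        exact hi' hi
  have := hle.trans (card_le_card hsub)
  have hc := card_compl_add_card (univ.biUnion G)
  rw [Fintype.card_fin] at hc
  rw [card_map]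
  omega

lemma dens_toNat_le_iff {F : Finset (Finset (Fin n))} {m : ℕ} :
    (dens (toNat F) n ≤ (m + 1) / 2 ^ m ↔ F.card * 2 ^ m ≤ (m + 1) * 2 ^ n) ∧
      (dens (toNat F) n = (m + 1) / 2 ^ m ↔ F.card * 2 ^ m = (m + 1) * 2 ^ n) := by
  rw [dens, card_toNat, div_le_div_iff₀ (by positivity) (by positivity),
    div_eq_div_iff (by positivity) (by positivity)]
  constructor <;> norm_cast

/-- The bound on `|F|`, with the characterization of equality, under agreement conditions for
every number `2 ≤ k ≤ r` of members. The compressions decrease the total weight, so induction on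
it reduces the claim to shifted down-sets. -/
lemma card_le_of_isAgreeing {r t : ℕ} (hr : 3 ≤ r) (ht : 1 ≤ t) (hrt : r + t + 2 ≤ 2 ^ r)
    {F : Finset (Finset (Fin n))} (hF : ∀ k, 2 ≤ k → k ≤ r → IsAgreeing k (r + t - k) F) :
    F.card * 2 ^ (r + t) ≤ (r + t + 1) * 2 ^ n ∧
      (F.card * 2 ^ (r + t) = (r + t + 1) * 2 ^ n →
        ∃ A R : Finset (Fin n), A.card = r + t ∧ R ⊆ A ∧ F = flippedFamily A R) := by
  induction hw : ∑ A ∈ F, weight A using Nat.strong_induction_on generalizing F with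
  | _ w ih =>
  subst hw
  by_cases hdown : ∃ x, downCompress x F ≠ F
  · obtain ⟨x, hx⟩ := hdown
    obtain ⟨h1, h2⟩ := ih _ (weight_downCompress_lt hx)
      (fun k hk hkr => isAgreeing_downCompress (hF k hk hkr) x) rfl
    rw [card_downCompress] at h1 h2
    refine ⟨h1, fun heq => ?_⟩
    obtain ⟨A, R, hA, hR, hE⟩ := h2 heq
    obtain ⟨R', hR', hF'⟩ := exists_eq_flippedFamily_of_downCompress
      (hA ▸ hF 3 (by norm_num) hr) (by omega) hR hE
    exact ⟨A, R', hA, hR', hF'⟩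
  push Not at hdown
  have herase : ∀ A ∈ F, ∀ x ∈ A, A.erase x ∈ F := by
    intro A hA x hx
    rw [← hdown x, mem_downCompress_of_mem hx] at hA
    exact hA.2
  by_cases hshift : ∃ i j, i < j ∧ shiftCompress i j F ≠ F
  · obtain ⟨i, j, hij, hne⟩ := hshift
    obtain ⟨h1, h2⟩ := ih _ (weight_shiftCompress_lt hij hne)
      (fun k hk hkr => isAgreeing_shiftCompress (hF k hk hkr) hij.ne) rfl
    rw [card_shiftCompress] at h1 h2
    refine ⟨h1, fun heq => ?_⟩
    obtain ⟨A, R, hA, hR, hE⟩ := h2 heq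
    have hR0 : R = ∅ := eq_empty_of_flippedFamily_erase (by omega) hR
      (hE ▸ erase_mem_shiftCompress hij.ne herase)
    subst hR0
    obtain ⟨A', hA', hF'⟩ := exists_eq_flippedFamily_of_shiftCompress hij.ne
      (hA ▸ hF 3 (by norm_num) hr) (by omega) hE
    exact ⟨A', ∅, hA'.trans hA, empty_subset _, hF'⟩
  push Not at hshift
  obtain ⟨h1, h2⟩ := (isShifted_toNat hdown hshift).dens_le hr ht hrt
    (fun k hk hkr => unionBounded_toNat herase hk (hF k hk hkr))
  have hle := (dens_toNat_le_iff (F := F) (m := r + t)).1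
  have heq := (dens_toNat_le_iff (F := F) (m := r + t)).2
  push_cast at hle heq
  refine ⟨hle.1 h1, fun h => ?_⟩
  obtain ⟨hn, hE⟩ := h2 (heq.2 h)
  have hA : (univ.filter fun x : Fin n => (x : ℕ) < r + t).map Fin.valEmbedding =
      Ico 0 (r + t) := by
    ext y
    simp only [mem_map, mem_filter, mem_univ, true_and, mem_Ico, Nat.zero_le]
    exact ⟨fun ⟨x, hx, hxy⟩ => hxy ▸ hx, fun hy => ⟨⟨y, by omega⟩, hy, rfl⟩⟩
  refine ⟨univ.filter fun x : Fin n => (x : ℕ) < r + t, ∅, ?_, empty_subset _, ?_⟩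
  · rw [← card_map Fin.valEmbedding, hA, Nat.card_Ico, Nat.sub_zero]
  · ext B
    rw [← map_val_mem_toNat, hE, mem_flippedFamily_empty, atMostOne, mem_filter, mem_powerset,
      ← hA, ← map_inter, card_map, and_iff_right]
    intro y hy
    obtain ⟨z, -, rfl⟩ := mem_map.1 hy
    simp

/-! ### Non-trivial families -/

/-- In a non-trivial family, agreement of `k + 1` members improves by one for `k` members: some
further member separates from them a coordinate on which they agree. -/
lemma isAgreeing_pred {F : Finset (Finset (Fin n))} (hF : IsNontrivial F)
    {k t : ℕ} (hk : 1 ≤ k) (ht : 1 ≤ t) (h : IsAgreeing (k + 1) t F) :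
    IsAgreeing k (t + 1) F := by
  intro G hG
  have hcons : ∀ B ∈ F, t ≤ (agreementSet (Fin.cons B G : Fin (k + 1) → Finset (Fin n))).card :=
    fun B hB => h _ (Fin.cases hB hG)
  have hmem : ∀ B y, y ∈ agreementSet (Fin.cons B G : Fin (k + 1) → Finset (Fin n)) ↔
      (y ∈ B ∧ ∀ i, y ∈ G i) ∨ (y ∉ B ∧ ∀ i, y ∉ G i) := by
    intro B y
    simp [mem_agreementSet, Fin.forall_fin_succ]
  have hex : ∃ x ∈ agreementSet G, ∃ B ∈ F, ¬ (x ∈ B ↔ x ∈ G ⟨0, hk⟩) := by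
    obtain ⟨x, hx⟩ := card_pos.1 (lt_of_lt_of_le (by omega) (hcons _ (hG ⟨0, hk⟩)))
    rw [hmem] at hx
    rcases hx with ⟨hx0, hx⟩ | ⟨hx0, hx⟩
    · refine ⟨x, mem_agreementSet.2 (Or.inl hx), ?_⟩
      by_contra! hall
      have hle : {x} ≤ F.inf id :=
        Finset.le_inf fun B hB => singleton_subset_iff.2 ((hall B hB).2 hx0)
      rw [hF.1] at hle
      exact notMem_empty x (singleton_subset_iff.1 hle)
    · refine ⟨x, mem_agreementSet.2 (Or.inr hx), ?_⟩
      by_contra! hall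
      have hle : F.sup id ≤ univ.erase x :=
        Finset.sup_le fun B hB y hy =>
          mem_erase.2 ⟨fun e => hx0 ((hall B hB).1 (e ▸ hy)), mem_univ y⟩
      rw [hF.2] at hle
      exact notMem_erase x univ (hle (mem_univ x))
  obtain ⟨x, hxG, B, hB, hxB⟩ := hex
  have hsub : agreementSet (Fin.cons B G : Fin (k + 1) → Finset (Fin n)) ⊆
      (agreementSet G).erase x := by
    intro y hy
    rw [hmem] at hy
    refine mem_erase.2 ⟨?_, mem_agreementSet.2 (hy.imp And.right And.right)⟩
    rintro rfl
    rcases hy with ⟨h1, h2⟩ | ⟨h1, h2⟩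
    · exact hxB (iff_of_true h1 (h2 _))
    · exact hxB (iff_of_false h1 (h2 _))
  have h1 := (hcons B hB).trans (card_le_card hsub)
  have h2 := card_erase_add_one hxG
  omega

lemma isAgreeing_of_le {F : Finset (Finset (Fin n))} (hF : IsNontrivial F)
    {r t : ℕ} (ht : 1 ≤ t) (h : IsAgreeing r t F) {k : ℕ} (hk : 1 ≤ k) (hkr : k ≤ r) :
    IsAgreeing k (r + t - k) F := by
  induction hkr using Nat.decreasingInduction with
  | self => rwa [Nat.add_sub_cancel_left]
  | of_succ k hkr ih =>
    have := isAgreeing_pred hF hk (by omega) (ih (by omega))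
    rwa [show r + t - (k + 1) + 1 = r + t - k by omega] at this

/-! ### The extremal families -/

lemma isNontrivial_flippedFamily {A R : Finset (Fin n)} : IsNontrivial (flippedFamily A R) := by
  -- `R` and `R ∆ {x}` are members which disagree on `x`
  have hR : R ∈ flippedFamily A R := by
    rw [mem_flippedFamily, symmDiff_self]; simp
  have hRx : ∀ x, symmDiff R {x} ∈ flippedFamily A R := by
    intro x
    rw [mem_flippedFamily, symmDiff_comm R, symmDiff_symmDiff_cancel_right]
    exact (card_le_card inter_subset_left).trans (card_singleton x).le
  constructor
  · rw [eq_empty_iff_forall_notMem]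
    intro x hx
    have h1 : x ∈ R := (Finset.inf_le (f := id) hR : _ ≤ R) hx
    have h2 : x ∈ symmDiff R {x} := (Finset.inf_le (f := id) (hRx x) : _ ≤ symmDiff R {x}) hx
    simp [mem_symmDiff, h1] at h2
  · rw [eq_univ_iff_forall]
    intro x
    by_cases hx : x ∈ R
    · exact (Finset.le_sup (f := id) hR : R ≤ _) hx
    · refine (Finset.le_sup (f := id) (hRx x) : symmDiff R {x} ≤ _) ?_
      simp [hx]

lemma isAgreeing_flippedFamily {A R : Finset (Fin n)} {r t : ℕ} (hA : A.card = r + t) :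
    IsAgreeing r t (flippedFamily A R) := by
  intro G hG
  have hsub : A \ univ.biUnion (fun i => symmDiff (G i) R ∩ A) ⊆ agreementSet G := by
    intro y hy
    simp only [mem_sdiff, mem_biUnion, mem_univ, true_and, not_exists, mem_inter,
      mem_symmDiff] at hy
    rw [mem_agreementSet]
    have hy' : ∀ i, (y ∈ G i ↔ y ∈ R) := fun i => by have := hy.2 i; tauto
    by_cases hR : y ∈ R
    · exact Or.inl fun i => (hy' i).2 hR
    · exact Or.inr fun i h => hR ((hy' i).1 h)
  have hU : (univ.biUnion (fun i => symmDiff (G i) R ∩ A)).card ≤ r := by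
    refine (card_biUnion_le_card_mul univ _ 1 fun i _ => mem_flippedFamily.1 (hG i)).trans ?_
    simp
  have h1 := card_le_card hsub
  have h2 := le_card_sdiff (univ.biUnion (fun i => symmDiff (G i) R ∩ A)) A
  omega

lemma card_flippedFamily (A R : Finset (Fin n)) :
    (flippedFamily A R).card * 2 ^ A.card = (A.card + 1) * 2 ^ n := by
  have h := card_atMostOne (subset_univ A)
  rw [card_univ, Fintype.card_fin] at h
  rw [← h, flippedFamily, card_image_of_injective _ (symmDiff_left_injective R), atMostOne,
    powerset_univ]

lemma card_eq_mul_zpow_iff {F : Finset (Finset (Fin n))} {r t : ℕ} :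
    (F.card : ℚ) = ((r : ℚ) + t + 1) * 2 ^ ((n : ℤ) - r - t) ↔
      F.card * 2 ^ (r + t) = (r + t + 1) * 2 ^ n := by
  rw [sub_sub, zpow_sub₀ two_ne_zero, ← mul_div_assoc, eq_div_iff (by positivity)]
  norm_cast

end Agreeing

open Agreeing in
theorem mainTheorem2 (n r t : ℕ) (hr : 3 ≤ r) (ht : 1 ≤ t) (htr : t < 2 ^ r - r - 1)
    (F : Finset (Finset (Fin n))) :
    (IsNontrivial F ∧ IsAgreeing r t F ∧
        (F.card : ℚ) = ((r : ℚ) + t + 1) * 2 ^ ((n : ℤ) - r - t)) ↔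
      ∃ A R : Finset (Fin n), A.card = r + t ∧ R ⊆ A ∧ F = flippedFamily A R := by
  rw [card_eq_mul_zpow_iff]
  constructor
  · rintro ⟨hF, hagr, hcard⟩
    exact (card_le_of_isAgreeing hr ht (by omega) fun k hk hkr =>
      isAgreeing_of_le hF ht hagr (by omega) hkr).2 hcard
  · rintro ⟨A, R, hA, -, rfl⟩
    refine ⟨isNontrivial_flippedFamily, isAgreeing_flippedFamily hA, ?_⟩
    rw [← hA]
    exact card_flippedFamily A R
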